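/- Let $d\ge 1$, $m\ge 0$ be integers, and let $(X_i)_{i\ge1}$, $(Y_i)_{i\ge1}$ be sequences of random vectors in $\mathbb R^d$ on a common probability space, where $X_1$ has density $p_X$ and $Y_1$ has density $p_Y$, with $p_X,p_Y\in L_3(\mathbb R^d)$. Assume: ($\mathcal A_1$) the sequence of pairs $(X_i,Y_i)_{i\ge1}$ is strictly stationary and $m$-dependent, i.e. with $W_i=(X_i,Y_i)$, the families $\{W_1,\dots,W_b\}$ and $\{W_{b+k},\dots,W_{b+k+l}\}$ are independent for all integers $b,k,l\ge1$ with $k>m$; ($\mathcal A_2$) for all integers $s,t\ge1$, the random vectors $X_1-X_{1+s}$ and $X_s-Y_t$ have bounded densities. Let $\epsilon=\epsilon(n)>0$ with $\epsilon(n)\to0$ as $n\to\infty$, let $b_\epsilon(d)$ be the volume of a Euclidean ball of radius $\epsilon$ in $\mathbb R^d$, and for $(k,l)\in\{(2,0),(1,1)\}$ put $q_{k,l}=\int_{\mathbb R^d}p_X(x)^kp_Y(x)^l\,dx$ and $\tilde Q_{k,l,n}=Q_{k,l,n}/b_\epsilon(d)$, where $$Q_{2,0,n}=\binom n2^{-1}\sum_{1\le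 i<j\le n}I(|X_i-X_j|\le\epsilon),\qquad Q_{1,1,n}=\frac1{n^2}\sum_{i=1}^n\sum_{j=1}^nI(|X_i-Y_j|\le\epsilon).$$ With $g(x,y)=\tfrac12(p_Y(x)+p_X(y))$, let $$\sigma^2_{2,0}=\mathrm{Var}(p_X(X_1))+2\sum_{h=1}^m\mathrm{Cov}(p_X(X_1),p_X(X_{1+h})),$$ $$\sigma^2_{1,1}=\mathrm{Var}(g(X_1,Y_1))+2\sum_{h=1}^m\mathrm{Cov}(g(X_1,Y_1),g(X_{1+h},Y_{1+h})).$$ For $0<\alpha\le1$ and $K>0$ let $H_2^{(\alpha)}(K)$ be the set of $p\in L_2(\mathbb R^d)$ with $\left(\int_{\mathbb R^d}(p(x-h)-p(x))^2dx\right)^{1/2}\le K|h|^\alpha$ whenever $|h|\le1$. Call a real sequence $L(n)$, $n\ge 1$, slowly varying if $L(n)>0$ for all large $n$ and $L(\lfloor\lambda n\rfloor)/L(n)\to1$ for every $\lambda>0$. Then, for $(k,l)=(2,0)$ and for $(k,l)=(1,1)$, as $n\to\infty$: (i) If $n^2\epsilon^d\to\infty$, then $\mathrm E(\tilde Q_{k,l,n}-q_{k,l})^2\to0$.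 (ii) If $p_X,p_Y\in H_2^{(\alpha)}(K)$ with $0<\alpha\le\min(1,d/4)$, $K>0$, and $\epsilon\sim cn^{-2/(4\alpha+d)}$ with $c>0$, then $\mathrm E(\tilde Q_{k,l,n}-q_{k,l})^2=O(n^{-8\alpha/(4\alpha+d)})$. (iii) If $p_X,p_Y\in H_2^{(\alpha)}(K)$ with $d/4<\alpha\le1$, $K>0$, and $\epsilon\sim L(n)n^{-1/d}$ with $L$ slowly varying and $L(n)\to\infty$, then $\mathrm E(\tilde Q_{k,l,n}-q_{k,l})^2=4\sigma^2_{k,l}n^{-1}+o(n^{-1})$. -/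

import Mathlib

open MeasureTheory ProbabilityTheory Filter Topology Asymptotics

noncomputable section

namespace ClosePairs

/-- A real-valued measurable non-negative function `p` is a (Lebesgue) density of the random
`d`-vector `U`. -/
def IsDensity {Ω : Type*} [MeasurableSpace Ω] (P : Measure Ω) {d : ℕ}
    (U : Ω → EuclideanSpace ℝ (Fin d)) (p : EuclideanSpace ℝ (Fin d) → ℝ) : Prop :=
  Measurable p ∧ (∀ x, 0 ≤ p x) ∧
    P.map U = (volume : Measure (EuclideanSpace ℝ (Fin d))).withDensity
      (fun x => ENNReal.ofReal (p x))

/-- The random `d`-vector `U` has a bounded density. -/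
def HasBoundedDensity {Ω : Type*} [MeasurableSpace Ω] (P : Measure Ω) {d : ℕ}
    (U : Ω → EuclideanSpace ℝ (Fin d)) : Prop :=
  ∃ f : EuclideanSpace ℝ (Fin d) → ℝ, IsDensity P U f ∧ ∃ C : ℝ, ∀ x, f x ≤ C

/-- Strict stationarity of a sequence `W 1, W 2, …` (the value `W 0` plays no role):
finite-dimensional distributions are invariant under time shifts. -/
def StrictlyStationary {Ω S : Type*} [MeasurableSpace Ω] [MeasurableSpace S] (P : Measure Ω)
    (W : ℕ → Ω → S) : Prop :=
  ∀ (r : ℕ) (t : Fin r → ℕ), (∀ i, 1 ≤ t i) → ∀ h : ℕ,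
    P.map (fun ω (i : Fin r) => W (t i + h) ω) = P.map (fun ω (i : Fin r) => W (t i) ω)

/-- `m`-dependence of a sequence `W 1, W 2, …`: the families `W 1, …, W b` and
`W (b + k), …, W (b + k + l)` are independent whenever `k > m`. -/
def MDependent {Ω S : Type*} [MeasurableSpace Ω] [MeasurableSpace S] (P : Measure Ω)
    (m : ℕ) (W : ℕ → Ω → S) : Prop :=
  ∀ b k l : ℕ, 1 ≤ b → 1 ≤ k → 1 ≤ l → m < k →
    IndepFun (fun ω (i : Finset.Icc 1 b) => W i ω)
      (fun ω (j : Finset.Icc (b + k) (b + k + l)) => W j ω) P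

/-- The smoothness class of square integrable functions on `ℝ^d` that are `α`-Hölder in
`L²`-norm with constant `K`. -/
def HolderL2 {d : ℕ} (α K : ℝ) (p : EuclideanSpace ℝ (Fin d) → ℝ) : Prop :=
  MemLp p 2 volume ∧
    ∀ h : EuclideanSpace ℝ (Fin d), ‖h‖ ≤ 1 →
      Real.sqrt (∫ x, (p (x - h) - p x) ^ 2) ≤ K * ‖h‖ ^ α

/-- Slow variation of `L(n)`, `n ≥ 1`. -/
def SlowlyVarying (L : ℕ → ℝ) : Prop :=
  (∀ᶠ n in atTop, 0 < L n) ∧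
    ∀ c : ℝ, 0 < c → Tendsto (fun n : ℕ => L ⌊c * (n : ℝ)⌋₊ / L n) atTop (𝓝 1)

/-- The functional `q_{k,l} = ∫ p_X^k p_Y^l`. -/
def qFun {d : ℕ} (pX pY : EuclideanSpace ℝ (Fin d) → ℝ) (k l : ℕ) : ℝ :=
  ∫ x, pX x ^ k * pY x ^ l

/-- Volume `b_ε(d)` of the closed Euclidean ball of radius `ε` in `ℝ^d`. -/
def ballVol (d : ℕ) (ε : ℝ) : ℝ :=
  (volume : Measure (EuclideanSpace ℝ (Fin d))).real (Metric.closedBall 0 ε)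

open Classical in
/-- The indicator of the event that `x` and `y` are `ε`-close. -/
def close {d : ℕ} (ε : ℝ) (x y : EuclideanSpace ℝ (Fin d)) : ℝ :=
  if dist x y ≤ ε then 1 else 0

/-- The one-sample statistic `Q_{2,0,n}`. -/
def Q20 {Ω : Type*} {d : ℕ} (X : ℕ → Ω → EuclideanSpace ℝ (Fin d)) (ε : ℝ) (n : ℕ) (ω : Ω) : ℝ :=
  (1 / (n.choose 2 : ℝ)) *
    ∑ j ∈ Finset.Icc 1 n, ∑ i ∈ Finset.Ico 1 j, close ε (X i ω) (X j ω)

/-- The two-sample statistic `Q_{1,1,n}`. -/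
def Q11 {Ω : Type*} {d : ℕ} (X Y : ℕ → Ω → EuclideanSpace ℝ (Fin d)) (ε : ℝ) (n : ℕ) (ω : Ω) : ℝ :=
  (1 / (n : ℝ) ^ 2) *
    ∑ i ∈ Finset.Icc 1 n, ∑ j ∈ Finset.Icc 1 n, close ε (X i ω) (Y j ω)

/-- The estimator `Q_{2,0,n} / b_ε(d)`. -/
def Q20Tilde {Ω : Type*} {d : ℕ} (X : ℕ → Ω → EuclideanSpace ℝ (Fin d)) (ε : ℝ) (n : ℕ)
    (ω : Ω) : ℝ :=
  Q20 X ε n ω / ballVol d ε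

/-- The estimator `Q_{1,1,n} / b_ε(d)`. -/
def Q11Tilde {Ω : Type*} {d : ℕ} (X Y : ℕ → Ω → EuclideanSpace ℝ (Fin d)) (ε : ℝ) (n : ℕ)
    (ω : Ω) : ℝ :=
  Q11 X Y ε n ω / ballVol d ε

/-- The mean square error `E (T - q)²`. -/
def mse {Ω : Type*} [MeasurableSpace Ω] (P : Measure Ω) (T : Ω → ℝ) (q : ℝ) : ℝ :=
  ∫ ω, (T ω - q) ^ 2 ∂P

/-- For a sequence `V 1, V 2, …`: `Var (V 1) + 2 ∑_{h=1}^m Cov (V 1, V (1 + h))`. -/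
def longRunVar {Ω : Type*} [MeasurableSpace Ω] (P : Measure Ω) (m : ℕ) (V : ℕ → Ω → ℝ) : ℝ :=
  variance (V 1) P + 2 * ∑ h ∈ Finset.Icc 1 m, covariance (V 1) (V (1 + h)) P

/-- `σ²_{2,0}`. -/
def sigmaSq20 {Ω : Type*} [MeasurableSpace Ω] (P : Measure Ω) {d : ℕ} (m : ℕ)
    (X : ℕ → Ω → EuclideanSpace ℝ (Fin d)) (pX : EuclideanSpace ℝ (Fin d) → ℝ) : ℝ :=
  longRunVar P m (fun i ω => pX (X i ω))

/-- `σ²_{1,1}`, built on `g(X_i, Y_i) = (p_Y(X_i) + p_X(Y_i)) / 2`. -/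
def sigmaSq11 {Ω : Type*} [MeasurableSpace Ω] (P : Measure Ω) {d : ℕ} (m : ℕ)
    (X Y : ℕ → Ω → EuclideanSpace ℝ (Fin d)) (pX pY : EuclideanSpace ℝ (Fin d) → ℝ) : ℝ :=
  longRunVar P m (fun i ω => (1 / 2 : ℝ) * (pY (X i ω) + pX (Y i ω)))

end ClosePairs

end

/-! Both statistics are instances of one object, `weightedStat`: a weighted average of the
normalised kernel `close ε x y / ballVol d ε` over pairs `(U i, V j)`. The one-sample statistic
takes `U = V = X` with the diagonal weighted zero; the two-sample statistic takes `U = X`, `V = Y`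
with all weights one. Write `f`, `g` for the densities of `U 1`, `V 1` and `q = ∫ f g`.

A Hoeffding decomposition (`weightedStat_sub_eq`) splits the error into the linear term `(2/n) ∑
((g(U i) + f(V i))/2 - q)` and three remainders. (a) The linear term with `g`, `f` replaced by their
ball averages, minus the original one. Its second moment is `o(1/n)`, because a sum of `m`-dependent
variables has variance at most `(2m+1) n` times a single one, and ball averages converge in `L²` of
the laws (`tendsto_integral_smooth_sub_sq`). The latter rests on Lebesgue differentiation, Jensen
and a dominated convergence argument in `L³`, followed by Hölder; this is the role of the `L³`
assumption. (b) The sum of the degenerate kernels `resid`. The expectation of a product of two of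
them vanishes as soon as one of the four indices is more than `m` away from the others, and the
remaining `O(n²)` quadruples each contribute `O(1/b)`, where `b = ballVol d ε`
(`integral_sum_resid_sq_le`, `exists_resid_bound`). Bounded densities of the differences give the
`1/b`. The total is `O(1/(n² b))`. (c) The bias `smoothMean ε f g - q`. It tends to zero in general,
and is at most `K² ε^(2α)` under Hölder smoothness, since the ball is symmetric and only second
differences of the correlation `h ↦ ∫ f(x) g(x+h)` matter (`abs_integral_mul_smooth_sub_le`).

The linear term has second moment `4σ²/n + o(1/n)`. All of this is recorded in
`exists_linearization`; the three regimes then compare `1/n`, `1/(n² ε^d)` and `ε^(4α)`. In (ii) the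
choice of `ε` balances the last two, and `α ≤ d/4` makes `1/n` no larger. In (iii) `n ε^d → ∞` and
`4α/d > 1` make both `o(1/n)`, because `L` grows more slowly than every power. -/

namespace ClosePairs

/-! ### The closeness kernel and averages over balls. -/

/-- Average of `g` over the closed ball of radius `ε` around `x`. -/
noncomputable def smooth {d : ℕ} (ε : ℝ) (g : EuclideanSpace ℝ (Fin d) → ℝ)
    (x : EuclideanSpace ℝ (Fin d)) : ℝ :=
  (∫ y, close ε x y * g y) / ballVol d ε

section Kernel

variable {d : ℕ} {ε : ℝ}

lemma ballVol_pos (hε : 0 < ε) : 0 < ballVol d ε := by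
  rw [ballVol, measureReal_def]
  exact ENNReal.toReal_pos (Metric.measure_closedBall_pos volume _ hε).ne'
    measure_closedBall_lt_top.ne

lemma ballVol_eq (hε : 0 ≤ ε) : ballVol d ε = ε ^ d * ballVol d 1 := by
  rw [ballVol, ballVol, Measure.addHaar_real_closedBall' _ _ hε]
  simp

lemma close_nonneg (x y : EuclideanSpace ℝ (Fin d)) : 0 ≤ close ε x y := by
  unfold close; split_ifs <;> norm_num

lemma close_le_one (x y : EuclideanSpace ℝ (Fin d)) : close ε x y ≤ 1 := by
  unfold close; split_ifs <;> norm_num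

lemma close_sq (x y : EuclideanSpace ℝ (Fin d)) : close ε x y ^ 2 = close ε x y := by
  unfold close; split_ifs <;> norm_num

lemma close_comm (x y : EuclideanSpace ℝ (Fin d)) : close ε x y = close ε y x := by
  unfold close; rw [dist_comm]

lemma close_self_add (x h : EuclideanSpace ℝ (Fin d)) : close ε x (x + h) = close ε 0 h := by
  unfold close; simp

lemma close_zero_neg (h : EuclideanSpace ℝ (Fin d)) : close ε 0 (-h) = close ε 0 h := by
  unfold close; simp

lemma close_eq_close_zero_sub (x y : EuclideanSpace ℝ (Fin d)) :
    close ε x y = close ε 0 (x - y) := by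
  unfold close; rw [dist_eq_norm, dist_zero_left]

lemma measurable_close :
    Measurable fun p : EuclideanSpace ℝ (Fin d) × EuclideanSpace ℝ (Fin d) =>
      close ε p.1 p.2 := by
  unfold close
  exact Measurable.ite (measurableSet_le (by fun_prop) measurable_const)
    measurable_const measurable_const

@[fun_prop]
lemma measurable_close_comp {α : Type*} [MeasurableSpace α]
    {u v : α → EuclideanSpace ℝ (Fin d)} (hu : Measurable u) (hv : Measurable v) :
    Measurable fun a => close ε (u a) (v a) := by
  have h := (measurable_close (ε := ε) (d := d)).comp (hu.prodMk hv)
  exact h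

lemma close_mul_eq_indicator (x : EuclideanSpace ℝ (Fin d)) (g : EuclideanSpace ℝ (Fin d) → ℝ) :
    (fun y => close ε x y * g y) = (Metric.closedBall x ε).indicator g := by
  ext y
  by_cases h : dist x y ≤ ε
  · rw [Set.indicator_of_mem (by simpa [dist_comm] using h)]; simp [close, h]
  · rw [Set.indicator_of_notMem (by simpa [dist_comm] using h)]; simp [close, h]

lemma close_eq_indicator (x : EuclideanSpace ℝ (Fin d)) :
    close ε x = (Metric.closedBall x ε).indicator 1 := by
  have := close_mul_eq_indicator (ε := ε) x 1
  simpa using this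

lemma integral_close (x : EuclideanSpace ℝ (Fin d)) : ∫ y, close ε x y = ballVol d ε := by
  rw [close_eq_indicator, integral_indicator_one Metric.isClosed_closedBall.measurableSet,
    ballVol, Measure.addHaar_real_closedBall_center]

lemma integrable_close (x : EuclideanSpace ℝ (Fin d)) : Integrable (close ε x) := by
  rw [close_eq_indicator]
  exact (integrable_indicator_iff Metric.isClosed_closedBall.measurableSet).2
    (integrableOn_const measure_closedBall_lt_top.ne)

lemma lintegral_close (x : EuclideanSpace ℝ (Fin d)) :
    ∫⁻ y, ENNReal.ofReal (close ε x y) = ENNReal.ofReal (ballVol d ε) := by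
  rw [← integral_close x, ofReal_integral_eq_lintegral_ofReal (integrable_close x)
    (Eventually.of_forall fun y => close_nonneg x y)]

lemma integrable_close_mul {g : EuclideanSpace ℝ (Fin d) → ℝ} (hg : Integrable g)
    (x : EuclideanSpace ℝ (Fin d)) : Integrable fun y => close ε x y * g y := by
  rw [close_mul_eq_indicator]
  exact hg.indicator Metric.isClosed_closedBall.measurableSet

lemma smooth_eq_average (g : EuclideanSpace ℝ (Fin d) → ℝ) (x : EuclideanSpace ℝ (Fin d)) :
    smooth ε g x = ⨍ y in Metric.closedBall x ε, g y := by
  rw [smooth, close_mul_eq_indicator, integral_indicator Metric.isClosed_closedBall.measurableSet,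
    setAverage_eq, Measure.addHaar_real_closedBall_center, ← ballVol, smul_eq_mul, div_eq_inv_mul]

lemma smooth_nonneg {g : EuclideanSpace ℝ (Fin d) → ℝ} (hg : ∀ x, 0 ≤ g x)
    (x : EuclideanSpace ℝ (Fin d)) : 0 ≤ smooth ε g x :=
  div_nonneg (integral_nonneg fun y => mul_nonneg (close_nonneg _ _) (hg y)) measureReal_nonneg

lemma smooth_le {g : EuclideanSpace ℝ (Fin d) → ℝ} (hg : ∀ x, 0 ≤ g x) (hgi : Integrable g)
    (x : EuclideanSpace ℝ (Fin d)) : smooth ε g x ≤ (∫ y, g y) / ballVol d ε := by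
  refine div_le_div_of_nonneg_right ?_ measureReal_nonneg
  exact integral_mono (integrable_close_mul hgi x) hgi
    fun y => mul_le_of_le_one_left (hg y) (close_le_one _ _)

@[fun_prop]
lemma measurable_smooth {g : EuclideanSpace ℝ (Fin d) → ℝ} (hg : Measurable g) :
    Measurable (smooth ε g) := by
  unfold smooth
  refine Measurable.div_const ?_ _
  have : StronglyMeasurable (Function.uncurry fun x y : EuclideanSpace ℝ (Fin d) =>
      close ε x y * g y) := by
    apply Measurable.stronglyMeasurable
    unfold Function.uncurry
    fun_prop
  exact this.integral_prod_right.measurable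

/-- Tonelli and the symmetry of the kernel: each `y` is seen from a ball of points `x` of volume
`ballVol d ε`, which cancels the normalisation. Conservation of mass is what keeps the integrals of
the dominating functions constant in `ε` below. -/
lemma lintegral_smooth (hε : 0 < ε) {g : EuclideanSpace ℝ (Fin d) → ℝ} (hg : ∀ x, 0 ≤ g x)
    (hgm : Measurable g) (hgi : Integrable g) :
    ∫⁻ x, ENNReal.ofReal (smooth ε g x) = ∫⁻ x, ENNReal.ofReal (g x) := by
  have hb := ballVol_pos (d := d) hε
  have h1 : ∀ x, ENNReal.ofReal (smooth ε g x) =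
      (ENNReal.ofReal (ballVol d ε))⁻¹ *
        ∫⁻ y, ENNReal.ofReal (close ε x y) * ENNReal.ofReal (g y) := by
    intro x
    rw [smooth, ENNReal.ofReal_div_of_pos hb, ENNReal.div_eq_inv_mul,
      ofReal_integral_eq_lintegral_ofReal (integrable_close_mul hgi x)
        (Eventually.of_forall fun y => mul_nonneg (close_nonneg x y) (hg y))]
    simp_rw [ENNReal.ofReal_mul (close_nonneg x _)]
  simp_rw [h1]
  rw [lintegral_const_mul' _ _ (by simpa using hb),
    lintegral_lintegral_swap (by unfold Function.uncurry; fun_prop)]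
  have h2 : ∀ y, ∫⁻ x, ENNReal.ofReal (close ε x y) * ENNReal.ofReal (g y)
      = ENNReal.ofReal (ballVol d ε) * ENNReal.ofReal (g y) := by
    intro y
    rw [lintegral_mul_const' _ _ ENNReal.ofReal_ne_top]
    simp_rw [close_comm _ y]
    rw [lintegral_close]
  simp_rw [h2]
  rw [lintegral_const_mul' _ _ ENNReal.ofReal_ne_top, ← mul_assoc,
    ENNReal.inv_mul_cancel (by simpa using hb) ENNReal.ofReal_ne_top, one_mul]

/-- Jensen for the uniform law on the ball. It provides the majorant for convergence in `L³`. -/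
lemma smooth_pow_three_le (hε : 0 < ε) {g : EuclideanSpace ℝ (Fin d) → ℝ} (hg : ∀ x, 0 ≤ g x)
    (hgi : Integrable g) (hg3 : Integrable fun x => g x ^ 3) (x : EuclideanSpace ℝ (Fin d)) :
    smooth ε g x ^ 3 ≤ smooth ε (fun y => g y ^ 3) x := by
  rw [smooth_eq_average, smooth_eq_average]
  exact (convexOn_pow 3).map_set_average_le (continuous_pow 3).continuousOn isClosed_Ici
    (Metric.measure_closedBall_pos volume _ hε).ne' measure_closedBall_lt_top.ne
    (Eventually.of_forall fun y => hg y) hgi.integrableOn hg3.integrableOn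

/-- Lebesgue differentiation for balls, here with fixed centre `x`. -/
lemma ae_tendsto_smooth {g : EuclideanSpace ℝ (Fin d) → ℝ} (hgi : Integrable g) :
    ∀ᵐ x, Tendsto (fun ε => smooth ε g x) (𝓝[>] 0) (𝓝 (g x)) := by
  filter_upwards [IsUnifLocDoublingMeasure.ae_tendsto_average volume hgi.locallyIntegrable 1]
    with x hx
  have := hx (l := 𝓝[>] (0 : ℝ)) (fun _ => x) (fun ε => ε) tendsto_id (by
    filter_upwards [self_mem_nhdsWithin] with δ hδ
    have : (0 : ℝ) < δ := hδ
    simp [this.le])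
  simpa only [smooth_eq_average] using this

end Kernel

/-! ### Convergence of ball averages in `L³`. -/

/-- Generalised dominated convergence with a null limit: the dominating functions converge almost
everywhere and have constant finite integral. -/
lemma tendsto_lintegral_zero_of_le {α ι : Type*} [MeasurableSpace α] {μ : Measure α}
    {l : Filter ι} [l.IsCountablyGenerated] {h H : ι → α → ENNReal} {H₀ : α → ENNReal}
    (hm : ∀ i, Measurable (h i)) (Hm : ∀ i, Measurable (H i))
    (hle : ∀ᶠ i in l, ∀ x, h i x ≤ H i x)
    (hlim : ∀ᵐ x ∂μ, Tendsto (fun i => h i x) l (𝓝 0))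
    (Hlim : ∀ᵐ x ∂μ, Tendsto (fun i => H i x) l (𝓝 (H₀ x)))
    (hint : ∀ᶠ i in l, ∫⁻ x, H i x ∂μ = ∫⁻ x, H₀ x ∂μ) (hfin : ∫⁻ x, H₀ x ∂μ ≠ ⊤) :
    Tendsto (fun i => ∫⁻ x, h i x ∂μ) l (𝓝 0) := by
  rcases l.eq_or_neBot with rfl | hne
  · exact tendsto_bot
  set c := ∫⁻ x, H₀ x ∂μ with hc
  have h1 : ∀ᶠ i in l, ∫⁻ x, (H i x - h i x) ∂μ = c - ∫⁻ x, h i x ∂μ := by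
    filter_upwards [hle, hint] with i hi hi2
    rw [lintegral_sub' (hm i).aemeasurable _ (Eventually.of_forall hi), hi2]
    exact ((lintegral_mono hi).trans_lt (by rw [hi2]; exact hfin.lt_top)).ne
  -- Fatou applied to `H i - h i`, which tends to `H₀` almost everywhere.
  have h2 : c ≤ liminf (fun i => ∫⁻ x, (H i x - h i x) ∂μ) l := by
    calc c = ∫⁻ x, liminf (fun i => H i x - h i x) l ∂μ := by
          refine lintegral_congr_ae ?_
          filter_upwards [hlim, Hlim] with x hx hx2
          have := ENNReal.Tendsto.sub hx2 hx (Or.inr ENNReal.zero_ne_top)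
          rw [tsub_zero] at this
          exact this.liminf_eq.symm
      _ ≤ _ := lintegral_liminf_le fun i => (Hm i).sub (hm i)
  rw [ENNReal.tendsto_nhds_zero]
  intro η hη
  -- The main case needs the strict inequality `c - η < c`, which fails for `c = 0`; there the
  -- majorants already have integral zero.
  rcases eq_or_ne c 0 with hc0 | hc0
  · filter_upwards [hle, hint] with i hi hi2
    calc ∫⁻ x, h i x ∂μ ≤ ∫⁻ x, H i x ∂μ := lintegral_mono hi
      _ = 0 := by rw [hi2, hc0]
      _ ≤ η := zero_le
  · have h3 : c - η < liminf (fun i => ∫⁻ x, (H i x - h i x) ∂μ) l :=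
      (ENNReal.sub_lt_self hfin hc0 hη.ne').trans_le h2
    filter_upwards [eventually_lt_of_lt_liminf h3, h1, hle, hint] with i hi hi1 hle hi2
    rw [hi1] at hi
    by_contra! hcon
    exact absurd (tsub_le_tsub_left hcon.le c) hi.not_ge

section Approximation

variable {d : ℕ}

/-- The majorant `4 (smooth ε (g³) + g³)` varies with `ε`, but it converges almost everywhere to `8
g³` and its integral does not change, so the generalised dominated convergence lemma applies. -/
lemma tendsto_lintegral_smooth_sub {g : EuclideanSpace ℝ (Fin d) → ℝ} (hg : ∀ x, 0 ≤ g x)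
    (hgm : Measurable g) (hgi : Integrable g) (hg3 : Integrable fun x => g x ^ 3) :
    Tendsto (fun ε => ∫⁻ x, ENNReal.ofReal |smooth ε g x - g x| ^ 3) (𝓝[>] 0) (𝓝 0) := by
  have hg3' : ∀ x, 0 ≤ g x ^ 3 := fun x => pow_nonneg (hg x) 3
  have hpos : ∀ᶠ ε in 𝓝[>] (0 : ℝ), 0 < ε := self_mem_nhdsWithin
  refine tendsto_lintegral_zero_of_le
    (H := fun ε x => 4 * (ENNReal.ofReal (smooth ε (fun y => g y ^ 3) x)
      + ENNReal.ofReal (g x ^ 3)))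
    (H₀ := fun x => 4 * (ENNReal.ofReal (g x ^ 3) + ENNReal.ofReal (g x ^ 3)))
    (fun ε => by fun_prop) (fun ε => by fun_prop) ?_ ?_ ?_ ?_ ?_
  · filter_upwards [hpos] with ε hε x
    rw [← ENNReal.ofReal_pow (abs_nonneg _), ← ENNReal.ofReal_add (smooth_nonneg hg3' x) (hg3' x),
      show (4 : ENNReal) = ENNReal.ofReal 4 by simp, ← ENNReal.ofReal_mul (by norm_num)]
    apply ENNReal.ofReal_le_ofReal
    have h1 := smooth_pow_three_le hε hg hgi hg3 x
    have h2 := smooth_nonneg (ε := ε) hg x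
    have h3 := hg x
    have h4 : |smooth ε g x - g x| ≤ smooth ε g x + g x := by
      rw [abs_le]; constructor <;> linarith
    have h5 := pow_le_pow_left₀ (abs_nonneg _) h4 3
    -- The difference of the two sides is `3 (a + b) (a - b)²`.
    have h6 : (smooth ε g x + g x) ^ 3 ≤ 4 * (smooth ε g x ^ 3 + g x ^ 3) := by
      nlinarith [mul_nonneg (add_nonneg h2 h3) (sq_nonneg (smooth ε g x - g x))]
    linarith
  · filter_upwards [ae_tendsto_smooth hgi] with x hx
    have h1 : Tendsto (fun ε => |smooth ε g x - g x|) (𝓝[>] 0) (𝓝 0) := by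
      have := (hx.sub_const (g x)).abs
      simpa using this
    have h2 := ENNReal.tendsto_ofReal (h1.pow 3)
    simpa [ENNReal.ofReal_pow] using h2
  · filter_upwards [ae_tendsto_smooth hg3] with x hx
    exact ENNReal.Tendsto.const_mul ((ENNReal.tendsto_ofReal hx).add tendsto_const_nhds)
      (Or.inr (by simp))
  · filter_upwards [hpos] with ε hε
    rw [lintegral_const_mul' _ _ (by simp), lintegral_const_mul' _ _ (by simp),
      lintegral_add_right _ (by fun_prop), lintegral_add_right _ (by fun_prop),
      lintegral_smooth hε hg3' (by fun_prop) hg3]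
  · rw [lintegral_const_mul' _ _ (by simp), lintegral_add_right _ (by fun_prop),
      ← ofReal_integral_eq_lintegral_ofReal hg3 (Eventually.of_forall hg3')]
    finiteness

end Approximation

/-! ### Integration against a law with an `L³` density. -/

section WithDensity

variable {d : ℕ} {μ ν : Measure (EuclideanSpace ℝ (Fin d))}
  {f g : EuclideanSpace ℝ (Fin d) → ℝ}

lemma integral_of_density (hf : Measurable f) (hf0 : ∀ x, 0 ≤ f x)
    (hμ : μ = volume.withDensity fun x => ENNReal.ofReal (f x))
    (φ : EuclideanSpace ℝ (Fin d) → ℝ) : ∫ x, φ x ∂μ = ∫ x, f x * φ x := by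
  rw [hμ, integral_withDensity_eq_integral_toReal_smul (by fun_prop)
    (Eventually.of_forall fun x => ENNReal.ofReal_lt_top)]
  simp [hf0]

lemma integrable_density [IsFiniteMeasure μ] (hf : Measurable f) (hf0 : ∀ x, 0 ≤ f x)
    (hμ : μ = volume.withDensity fun x => ENNReal.ofReal (f x)) : Integrable f := by
  refine ⟨hf.aestronglyMeasurable, ?_⟩
  rw [hasFiniteIntegral_iff_ofReal (Eventually.of_forall hf0)]
  have := measure_lt_top μ Set.univ
  rwa [hμ, withDensity_apply _ MeasurableSet.univ, Measure.restrict_univ] at this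

lemma integral_density [IsProbabilityMeasure μ] (hf : Measurable f) (hf0 : ∀ x, 0 ≤ f x)
    (hμ : μ = volume.withDensity fun x => ENNReal.ofReal (f x)) : ∫ x, f x = 1 := by
  have := integral_of_density hf hf0 hμ fun _ => 1
  simpa using this.symm

lemma smooth_eq_integral {ε : ℝ} (hg : Measurable g) (hg0 : ∀ x, 0 ≤ g x)
    (hν : ν = volume.withDensity fun x => ENNReal.ofReal (g x)) (x : EuclideanSpace ℝ (Fin d)) :
    smooth ε g x = (∫ y, close ε x y ∂ν) / ballVol d ε := by
  rw [smooth, integral_of_density hg hg0 hν]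
  simp_rw [mul_comm (g _)]

lemma integrable_pow_three (hf0 : ∀ x, 0 ≤ f x) (hf3 : MemLp f 3) :
    Integrable fun x => f x ^ 3 := by
  have := hf3.integrable_norm_pow (by norm_num)
  simpa [abs_of_nonneg (hf0 _)] using this

/-- Hölder with exponents `3` and `3/2` for the product `f · h²`. It carries `L³` information under
Lebesgue measure over to `L²` under the law. -/
lemma lintegral_sq_le_of_density (hf : Measurable f)
    (hμ : μ = volume.withDensity fun x => ENNReal.ofReal (f x))
    {h : EuclideanSpace ℝ (Fin d) → ℝ} (hh : Measurable h) :
    ∫⁻ x, ENNReal.ofReal (h x ^ 2) ∂μ ≤ (∫⁻ x, ENNReal.ofReal (f x) ^ 3) ^ (1 / 3 : ℝ) *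
      (∫⁻ x, ENNReal.ofReal |h x| ^ 3) ^ (2 / 3 : ℝ) := by
  rw [hμ, lintegral_withDensity_eq_lintegral_mul _ (by fun_prop) (by fun_prop)]
  refine (ENNReal.lintegral_mul_le_Lp_mul_Lq volume (p := 3) (q := 3 / 2) ?_
    (by fun_prop) (by fun_prop)).trans_eq ?_
  · rw [Real.holderConjugate_iff]; norm_num
  · have h1 : ∀ x, ENNReal.ofReal (h x ^ 2) ^ (3 / 2 : ℝ) = ENNReal.ofReal |h x| ^ 3 := by
      intro x
      rw [← sq_abs, ENNReal.ofReal_pow (abs_nonneg _), ← ENNReal.rpow_natCast,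
        ← ENNReal.rpow_mul, ← ENNReal.rpow_natCast]
      norm_num
    have h2 : ∀ x, ENNReal.ofReal (f x) ^ (3 : ℝ) = ENNReal.ofReal (f x) ^ 3 := by
      intro x
      rw [← ENNReal.rpow_natCast]
      norm_num
    simp_rw [h1, h2]
    norm_num

lemma lintegral_ofReal_pow_three_ne_top (hf0 : ∀ x, 0 ≤ f x) (hf3 : MemLp f 3) :
    ∫⁻ x, ENNReal.ofReal (f x) ^ 3 ≠ ⊤ := by
  have h3 := integrable_pow_three hf0 hf3
  simp_rw [← ENNReal.ofReal_pow (hf0 _)]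
  rw [← ofReal_integral_eq_lintegral_ofReal h3 (Eventually.of_forall fun x => pow_nonneg (hf0 x) 3)]
  exact ENNReal.ofReal_ne_top

/-- This makes the variances in the linear term, and hence the long-run variance, finite. -/
lemma memLp_two_of_density (hf : Measurable f) (hf0 : ∀ x, 0 ≤ f x) (hf3 : MemLp f 3)
    (hμ : μ = volume.withDensity fun x => ENNReal.ofReal (f x))
    (hg : Measurable g) (hg0 : ∀ x, 0 ≤ g x) (hg3 : MemLp g 3) : MemLp g 2 μ := by
  rw [memLp_two_iff_integrable_sq hg.aestronglyMeasurable]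
  refine ⟨(hg.pow_const 2).aestronglyMeasurable, ?_⟩
  rw [hasFiniteIntegral_iff_ofReal (Eventually.of_forall fun x => sq_nonneg _)]
  refine (lintegral_sq_le_of_density hf hμ hg).trans_lt ?_
  simp_rw [abs_of_nonneg (hg0 _)]
  exact ENNReal.mul_lt_top
    (ENNReal.rpow_lt_top_of_nonneg (by norm_num) (lintegral_ofReal_pow_three_ne_top hf0 hf3))
    (ENNReal.rpow_lt_top_of_nonneg (by norm_num) (lintegral_ofReal_pow_three_ne_top hg0 hg3))

lemma memLp_smooth [IsFiniteMeasure μ] {ε : ℝ} (hg : Measurable g)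
    (hg0 : ∀ x, 0 ≤ g x) (hgi : Integrable g) (p : ENNReal) : MemLp (smooth ε g) p μ := by
  refine MemLp.of_bound (measurable_smooth hg).aestronglyMeasurable ((∫ y, g y) / ballVol d ε)
    (Eventually.of_forall fun x => ?_)
  rw [Real.norm_of_nonneg (smooth_nonneg hg0 x)]
  exact smooth_le hg0 hgi x

lemma tendsto_integral_smooth_sub_sq (hf : Measurable f) (hf0 : ∀ x, 0 ≤ f x) (hf3 : MemLp f 3)
    (hμ : μ = volume.withDensity fun x => ENNReal.ofReal (f x))
    (hg : Measurable g) (hg0 : ∀ x, 0 ≤ g x) (hgi : Integrable g) (hg3 : MemLp g 3) :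
    Tendsto (fun ε => ∫ x, (smooth ε g x - g x) ^ 2 ∂μ) (𝓝[>] 0) (𝓝 0) := by
  have h1 : Tendsto (fun ε => ∫⁻ x, ENNReal.ofReal ((smooth ε g x - g x) ^ 2) ∂μ)
      (𝓝[>] 0) (𝓝 0) := by
    refine tendsto_of_tendsto_of_tendsto_of_le_of_le tendsto_const_nhds
      (h := fun ε => (∫⁻ x, ENNReal.ofReal (f x) ^ 3) ^ (1 / 3 : ℝ) *
        (∫⁻ x, ENNReal.ofReal |smooth ε g x - g x| ^ 3) ^ (2 / 3 : ℝ)) ?_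
      (fun ε => zero_le) (fun ε => lintegral_sq_le_of_density hf hμ (by fun_prop))
    have h2 := (tendsto_lintegral_smooth_sub hg0 hg hgi (integrable_pow_three hg0 hg3)).ennrpow_const
      (2 / 3 : ℝ)
    have h3 := ENNReal.Tendsto.const_mul (a := (∫⁻ x, ENNReal.ofReal (f x) ^ 3) ^ (1 / 3 : ℝ)) h2
      (Or.inr (ENNReal.rpow_lt_top_of_nonneg (by norm_num)
        (lintegral_ofReal_pow_three_ne_top hf0 hf3)).ne)
    simpa using h3
  have h4 := (ENNReal.tendsto_toReal ENNReal.zero_ne_top).comp h1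
  refine h4.congr fun ε => ?_
  rw [integral_eq_lintegral_of_nonneg_ae (Eventually.of_forall fun x => sq_nonneg _)
    (by fun_prop)]
  rfl

end WithDensity

/-! ### The bias under Hölder smoothness. -/

section Bias

variable {d : ℕ} {f g : EuclideanSpace ℝ (Fin d) → ℝ}

lemma integrable_mul_translate (hf : MemLp f 2) (hg : MemLp g 2)
    (a b : EuclideanSpace ℝ (Fin d)) : Integrable fun x => f (x + a) * g (x + b) := by
  have h1 : MemLp (fun x => f (x + a)) 2 :=
    hf.comp_measurePreserving (measurePreserving_add_right volume a)
  have h2 : MemLp (fun x => g (x + b)) 2 :=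
    hg.comp_measurePreserving (measurePreserving_add_right volume b)
  exact h1.integrable_mul h2

/-- By translation invariance the symmetric second difference of the correlation equals `-∫ (f(x-h)
- f(x)) (g(x-h) - g(x))`. A product of two first differences yields the order `‖h‖^(2α)`, twice the
smoothness of either factor. -/
lemma abs_second_difference_le {α K : ℝ} (hf : HolderL2 α K f) (hg : HolderL2 α K g)
    {h : EuclideanSpace ℝ (Fin d)} (hh : ‖h‖ ≤ 1) :
    |(∫ x, f x * g (x + h)) + (∫ x, f x * g (x + -h)) - 2 * ∫ x, f x * g x| ≤
      (K * ‖h‖ ^ α) ^ 2 := by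
  have hL : ∀ {p : EuclideanSpace ℝ (Fin d) → ℝ}, HolderL2 α K p →
      ∫ x, (p (x - h) - p x) ^ 2 ≤ (K * ‖h‖ ^ α) ^ 2 := by
    intro p hp
    have h1 := hp.2 h hh
    have h0 : 0 ≤ ∫ x, (p (x - h) - p x) ^ 2 := integral_nonneg fun x => sq_nonneg _
    rw [← Real.sq_sqrt h0]
    exact pow_le_pow_left₀ (Real.sqrt_nonneg _) h1 2
  have hdiff : ∀ {p : EuclideanSpace ℝ (Fin d) → ℝ}, MemLp p 2 →
      Integrable fun x => (p (x - h) - p x) ^ 2 := by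
    intro p hp
    have h1 : MemLp (fun x => p (x - h)) 2 :=
      hp.comp_measurePreserving (measurePreserving_sub_right volume h)
    exact (h1.sub hp).integrable_sq
  have i1 := integrable_mul_translate hf.1 hg.1 (-h) (-h)
  have i2 := integrable_mul_translate hf.1 hg.1 (-h) 0
  have i3 := integrable_mul_translate hf.1 hg.1 0 (-h)
  have i4 := integrable_mul_translate hf.1 hg.1 0 0
  simp only [add_zero, ← sub_eq_add_neg] at i1 i2 i3 i4
  have key : ∫ x, (f (x - h) - f x) * (g (x - h) - g x) =
      2 * (∫ x, f x * g x) - (∫ x, f x * g (x + h)) - ∫ x, f x * g (x + -h) := by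
    have e1 : ∫ x, f (x - h) * g (x - h) = ∫ x, f x * g x :=
      integral_sub_right_eq_self (fun x => f x * g x) h
    have e2 : ∫ x, f (x - h) * g x = ∫ x, f x * g (x + h) := by
      have := integral_sub_right_eq_self (μ := volume) (fun x => f x * g (x + h)) h
      simpa using this
    have e3 : ∀ x, (f (x - h) - f x) * (g (x - h) - g x) =
        f (x - h) * g (x - h) - f (x - h) * g x - (f x * g (x - h) - f x * g x) := by
      intro x; ring
    have i12 : Integrable fun x => f (x - h) * g (x - h) - f (x - h) * g x := i1.sub i2
    have i34 : Integrable fun x => f x * g (x - h) - f x * g x := i3.sub i4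
    simp_rw [e3]
    rw [integral_sub i12 i34, integral_sub i1 i2, integral_sub i3 i4, e1, e2]
    simp only [← sub_eq_add_neg]
    ring
  have habs : |∫ x, (f (x - h) - f x) * (g (x - h) - g x)| ≤ (K * ‖h‖ ^ α) ^ 2 := by
    calc |∫ x, (f (x - h) - f x) * (g (x - h) - g x)|
        ≤ ∫ x, |(f (x - h) - f x) * (g (x - h) - g x)| := abs_integral_le_integral_abs
      _ ≤ ∫ x, ((f (x - h) - f x) ^ 2 / 2 + (g (x - h) - g x) ^ 2 / 2) := by
          refine integral_mono_of_nonneg (Eventually.of_forall fun x => abs_nonneg _)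
            (((hdiff hf.1).div_const 2).add ((hdiff hg.1).div_const 2))
            (Eventually.of_forall fun x => ?_)
          simp only [abs_mul]
          nlinarith [sq_nonneg (|f (x - h) - f x| - |g (x - h) - g x|),
            sq_abs (f (x - h) - f x), sq_abs (g (x - h) - g x)]
      _ = (∫ x, (f (x - h) - f x) ^ 2) / 2 + (∫ x, (g (x - h) - g x) ^ 2) / 2 := by
          rw [integral_add ((hdiff hf.1).div_const 2) ((hdiff hg.1).div_const 2),
            integral_div, integral_div]
      _ ≤ _ := by linarith [hL hf, hL hg]
  rw [key] at habs
  rw [abs_le] at habs ⊢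
  constructor <;> linarith [habs.1, habs.2]

/-- Substituting `y = x + h` and exchanging integrals turns the mean into a ball average of the
correlation `h ↦ ∫ f(x) g(x+h)`. -/
lemma integral_mul_smooth {ε : ℝ} (hf : Measurable f) (hg : Measurable g) (hfi : Integrable f)
    (hgi : Integrable g) :
    ∫ x, f x * smooth ε g x = (∫ h, close ε 0 h * ∫ x, f x * g (x + h)) / ballVol d ε ∧
      Integrable fun h => close ε 0 h * ∫ x, f x * g (x + h) := by
  have h1 : ∀ x, f x * smooth ε g x =
      (∫ h, close ε 0 h * (f x * g (x + h))) / ballVol d ε := by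
    intro x
    rw [smooth, ← integral_add_left_eq_self _ x, ← mul_div_assoc, ← integral_const_mul]
    simp_rw [close_self_add]
    congr 2
    ext y; ring
  have hint : Integrable (Function.uncurry fun x h => close ε 0 h * (f x * g (x + h)))
      (volume.prod volume) := by
    -- The shear `(x, h) ↦ (x, x + h)` preserves the product measure, so this is the integrability
    -- of `f ⊗ g`.
    have h2 : Integrable (fun p : EuclideanSpace ℝ (Fin d) × EuclideanSpace ℝ (Fin d) =>
        f p.1 * g (p.1 + p.2)) (volume.prod volume) :=
      (measurePreserving_prod_add volume volume).integrable_comp_of_integrable (hfi.mul_prod hgi)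
    refine h2.mono (Measurable.aestronglyMeasurable (by unfold Function.uncurry; fun_prop))
      (Eventually.of_forall fun p => ?_)
    simp only [Function.uncurry]
    rw [norm_mul, Real.norm_of_nonneg (close_nonneg _ _)]
    exact mul_le_of_le_one_left (norm_nonneg _) (close_le_one _ _)
  constructor
  · simp_rw [h1]
    rw [integral_div, integral_integral_swap hint]
    simp_rw [integral_const_mul]
  · have := hint.swap.integral_prod_left
    simpa [Function.uncurry, integral_const_mul] using this

/-- The ball is invariant under `h ↦ -h`, so only the even part of the correlation contributes.
Twice the bias is then the ball average of its second differences, each at most `(K ε^α)²`. -/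
lemma abs_integral_mul_smooth_sub_le {α K ε : ℝ} (hα : 0 ≤ α) (hε : 0 < ε) (hε1 : ε ≤ 1)
    (hf : Measurable f) (hg : Measurable g) (hfi : Integrable f) (hgi : Integrable g)
    (hfH : HolderL2 α K f) (hgH : HolderL2 α K g) :
    |(∫ x, f x * smooth ε g x) - ∫ x, f x * g x| ≤ (K * ε ^ α) ^ 2 := by
  set F : EuclideanSpace ℝ (Fin d) → ℝ := fun h => ∫ x, f x * g (x + h) with hF
  set q := ∫ x, f x * g x with hq
  have hb := ballVol_pos (d := d) hε
  obtain ⟨h1, h2⟩ := integral_mul_smooth (ε := ε) hf hg hfi hgi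
  have h2' : Integrable fun h => close ε 0 h * F (-h) := by
    have := h2.comp_neg
    simpa [close_zero_neg, hF] using this
  have h3 : ∫ h, close ε 0 h * F (-h) = ∫ h, close ε 0 h * F h := by
    rw [← integral_neg_eq_self]
    simp [close_zero_neg]
  have h4 : (∫ h, close ε 0 h * (F h + F (-h) - 2 * q)) =
      2 * ((∫ h, close ε 0 h * F h) - ballVol d ε * q) := by
    have : ∀ h, close ε 0 h * (F h + F (-h) - 2 * q) =
        close ε 0 h * F h + close ε 0 h * F (-h) - close ε 0 h * (2 * q) := by intro h; ring
    have hadd : Integrable fun h => close ε 0 h * F h + close ε 0 h * F (-h) := h2.add h2'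
    simp_rw [this]
    rw [integral_sub hadd ((integrable_close 0).mul_const _), integral_add h2 h2', h3,
      integral_mul_const, integral_close]
    ring
  have h5 : |∫ h, close ε 0 h * (F h + F (-h) - 2 * q)| ≤ ballVol d ε * (K * ε ^ α) ^ 2 := by
    calc _ ≤ ∫ h, |close ε 0 h * (F h + F (-h) - 2 * q)| := abs_integral_le_integral_abs
      _ ≤ ∫ h, close ε 0 h * (K * ε ^ α) ^ 2 := by
          refine integral_mono_of_nonneg (Eventually.of_forall fun x => abs_nonneg _)
            ((integrable_close 0).mul_const _) (Eventually.of_forall fun h => ?_)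
          simp only [abs_mul, abs_of_nonneg (close_nonneg _ _)]
          by_cases hh : ‖h‖ ≤ ε
          · refine mul_le_mul_of_nonneg_left ?_ (close_nonneg _ _)
            refine (abs_second_difference_le hfH hgH (hh.trans hε1)).trans ?_
            rw [mul_pow, mul_pow]
            gcongr
          · simp [close, hh]
      _ = _ := by rw [integral_mul_const, integral_close]
  rw [h4, abs_mul, abs_two] at h5
  rw [h1, div_sub' hb.ne', abs_div, abs_of_pos hb, div_le_iff₀ hb]
  have := abs_nonneg ((∫ h, close ε 0 h * F h) - ballVol d ε * q)
  linarith

end Bias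

/-! ### Independence of a single index from all distant ones. -/

/-- The σ-algebra generated by `W a`, `a ∈ s`. -/
abbrev sigmaGen {Ω S : Type*} [MeasurableSpace S] (W : ℕ → Ω → S) (s : Set ℕ) :
    MeasurableSpace Ω :=
  ⨆ a ∈ s, MeasurableSpace.comap (W a) inferInstance

lemma comap_le_iSup {Ω S : Type*} [MeasurableSpace S] {W : ℕ → Ω → S} {s : Set ℕ} {a : ℕ} (ha : a ∈ s) :
    MeasurableSpace.comap (W a) inferInstance ≤
      sigmaGen W s :=
  le_iSup₂ (f := fun a (_ : a ∈ s) => MeasurableSpace.comap (W a) inferInstance) a ha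

lemma comap_pi_eq_iSup {Ω S ι : Type*} [MeasurableSpace S] (Z : ι → Ω → S) :
    MeasurableSpace.comap (fun ω i => Z i ω) MeasurableSpace.pi =
      ⨆ i, MeasurableSpace.comap (Z i) inferInstance := by
  rw [MeasurableSpace.pi, MeasurableSpace.comap_iSup]
  simp_rw [MeasurableSpace.comap_comp]
  rfl

section Independence

variable {Ω S : Type*} [mΩ : MeasurableSpace Ω] [MeasurableSpace S] {P : Measure Ω}
  [IsProbabilityMeasure P] {m : ℕ} {W : ℕ → Ω → S}

/-- Read `m₁`, `m₂`, `m₃` as past, present and future: `m`-dependence only separates one side of a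
gap from the other, and this puts past and future on the same side. On the generating π-system of
sets `a ∩ c` the probability factorises by splitting off `a` first and then `b`. -/
lemma indep_sup_of_indep {m₁ m₂ m₃ : MeasurableSpace Ω} (h₁ : m₁ ≤ mΩ) (h₂ : m₂ ≤ mΩ)
    (h₃ : m₃ ≤ mΩ) (h : Indep m₁ (m₂ ⊔ m₃) P) (h' : Indep m₂ m₃ P) :
    Indep m₂ (m₁ ⊔ m₃) P := by
  set p : Set (Set Ω) := {s | ∃ a, MeasurableSet[m₁] a ∧ ∃ c, MeasurableSet[m₃] c ∧ s = a ∩ c}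
    with hp
  have hgen : m₁ ⊔ m₃ = MeasurableSpace.generateFrom p := by
    refine le_antisymm (sup_le ?_ ?_) (MeasurableSpace.generateFrom_le ?_)
    · intro s hs
      exact MeasurableSpace.measurableSet_generateFrom
        ⟨s, hs, Set.univ, MeasurableSet.univ, (Set.inter_univ s).symm⟩
    · intro s hs
      exact MeasurableSpace.measurableSet_generateFrom
        ⟨Set.univ, MeasurableSet.univ, s, hs, (Set.univ_inter s).symm⟩
    · rintro s ⟨a, ha, c, hc, rfl⟩
      exact MeasurableSet.inter ((le_sup_left : m₁ ≤ m₁ ⊔ m₃) _ ha)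
        ((le_sup_right : m₃ ≤ m₁ ⊔ m₃) _ hc)
  have hpi : IsPiSystem p := by
    rintro _ ⟨a, ha, c, hc, rfl⟩ _ ⟨a', ha', c', hc', rfl⟩ -
    exact ⟨a ∩ a', ha.inter ha', c ∩ c', hc.inter hc', Set.inter_inter_inter_comm _ _ _ _⟩
  refine IndepSets.indep h₂ (sup_le h₁ h₃) (@MeasurableSpace.isPiSystem_measurableSet Ω m₂) hpi
    (@MeasurableSpace.generateFrom_measurableSet Ω m₂).symm hgen ?_
  rw [IndepSets_iff]
  rintro b _ hb ⟨a, ha, c, hc, rfl⟩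
  rw [Indep_iff] at h h'
  have e1 := h a (b ∩ c) ha (MeasurableSet.inter ((le_sup_left : m₂ ≤ m₂ ⊔ m₃) _ hb)
    ((le_sup_right : m₃ ≤ m₂ ⊔ m₃) _ hc))
  have e2 := h' b c hb hc
  have e3 := h a c ha ((le_sup_right : m₃ ≤ m₂ ⊔ m₃) _ hc)
  rw [Set.inter_left_comm, e1, e2, e3]
  ring

/-- `MDependent` speaks of finite future blocks only; these increase to the whole future, and
independence passes to the directed supremum. -/
lemma indep_past_future (hW : ∀ i, 1 ≤ i → Measurable (W i)) (hm : MDependent P m W) (b : ℕ) :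
    Indep (sigmaGen W {a | 1 ≤ a ∧ a ≤ b})
      (sigmaGen W {a | b + m < a}) P := by
  -- `MDependent` requires `1 ≤ b`; the empty past generates the trivial σ-algebra.
  rcases Nat.eq_zero_or_pos b with rfl | hb
  · have : sigmaGen W {a | 1 ≤ a ∧ a ≤ 0} = ⊥ := by
      refine le_bot_iff.1 (iSup₂_le fun a ha => ?_)
      have h1 := ha.1
      have h2 := ha.2
      omega
    rw [this]
    exact indep_bot_left _
  have hle : ∀ s : Set ℕ, (∀ a ∈ s, 1 ≤ a) →
      sigmaGen W s ≤ mΩ :=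
    fun s hs => iSup₂_le fun a ha => (hW a (hs a ha)).comap_le
  have h1 : ∀ l : ℕ, Indep
      (sigmaGen W {a | b + m < a ∧ a ≤ b + m + 1 + (l + 1)})
      (sigmaGen W {a | 1 ≤ a ∧ a ≤ b}) P := by
    intro l
    have h2 := hm b (m + 1) (l + 1) hb (by omega) (by omega) (by omega)
    rw [IndepFun_iff_Indep, comap_pi_eq_iSup, comap_pi_eq_iSup] at h2
    refine indep_of_indep_of_le_left (indep_of_indep_of_le_right h2.symm ?_) ?_
    · refine iSup₂_le fun a ha => ?_
      exact le_iSup (fun i : Finset.Icc 1 b => MeasurableSpace.comap (W i) inferInstance)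
        ⟨a, Finset.mem_Icc.2 ha⟩
    · refine iSup₂_le fun a ha => ?_
      have h3 := ha.1
      have h4 := ha.2
      exact le_iSup (fun i : Finset.Icc (b + (m + 1)) (b + (m + 1) + (l + 1)) =>
        MeasurableSpace.comap (W i) inferInstance) ⟨a, Finset.mem_Icc.2 (by omega)⟩
  have h5 := indep_iSup_of_directed_le h1
    (fun l => hle _ fun a ha => by have := ha.1; omega) (hle _ fun a ha => ha.1) (by
      refine Monotone.directed_le fun l l' hl => ?_
      refine iSup₂_le fun a ha => comap_le_iSup ?_
      have h3 := ha.1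
      have h4 := ha.2
      exact ⟨h3, by omega⟩)
  refine indep_of_indep_of_le_right h5.symm ?_
  refine iSup₂_le fun a ha => ?_
  refine le_trans ?_ (le_iSup _ a)
  refine comap_le_iSup ?_
  have h3 : b + m < a := ha
  exact ⟨h3, by omega⟩

lemma indep_of_far (hW : ∀ i, 1 ≤ i → Measurable (W i)) (hm : MDependent P m W) {i : ℕ}
    (hi : 1 ≤ i) :
    Indep (MeasurableSpace.comap (W i) inferInstance)
      (sigmaGen W {a | 1 ≤ a ∧ (a + m < i ∨ i + m < a)})
      P := by
  have hle : ∀ s : Set ℕ, (∀ a ∈ s, 1 ≤ a) →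
      sigmaGen W s ≤ mΩ :=
    fun s hs => iSup₂_le fun a ha => (hW a (hs a ha)).comap_le
  have h1 : Indep (MeasurableSpace.comap (W i) inferInstance)
      (sigmaGen W {a | i + m < a}) P :=
    indep_of_indep_of_le_left (indep_past_future hW hm i) (comap_le_iSup ⟨hi, le_rfl⟩)
  have h2 : Indep (sigmaGen W {a | 1 ≤ a ∧ a ≤ i - m - 1})
      (MeasurableSpace.comap (W i) inferInstance ⊔ sigmaGen W {a | i + m < a}) P := by
    -- For `i ≤ m` the truncated subtraction gives `i - m - 1 = 0`, and indeed there is no distant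
    -- past.
    rcases Nat.lt_or_ge m i with hmi | hmi
    · refine indep_of_indep_of_le_right (indep_past_future hW hm (i - m - 1)) ?_
      refine sup_le (comap_le_iSup ?_) (iSup₂_le fun a ha => comap_le_iSup ?_)
      · show i - m - 1 + m < i
        omega
      · have h3 : i + m < a := ha
        show i - m - 1 + m < a
        omega
    · have : sigmaGen W {a | 1 ≤ a ∧ a ≤ i - m - 1} = ⊥ := by
        refine le_bot_iff.1 (iSup₂_le fun a ha => ?_)
        have h1 := ha.1
        have h2 := ha.2
        omega
      rw [this]
      exact indep_bot_left _
  have h3 := indep_sup_of_indep (hle _ fun a ha => ha.1) (hW i hi).comap_le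
    (hle _ fun a (ha : i + m < a) => by omega) h2 h1
  refine indep_of_indep_of_le_right h3 (iSup₂_le fun a ha => ?_)
  rcases ha with ⟨ha1, ha | ha⟩
  · exact le_sup_of_le_left (comap_le_iSup ⟨ha1, by omega⟩)
  · exact le_sup_of_le_right (comap_le_iSup ha)

lemma indepFun_of_far (hW : ∀ i, 1 ≤ i → Measurable (W i)) (hm : MDependent P m W) {i j : ℕ}
    (hi : 1 ≤ i) (hj : 1 ≤ j) (hij : j + m < i ∨ i + m < j) : IndepFun (W i) (W j) P := by
  rw [IndepFun_iff_Indep]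
  exact indep_of_indep_of_le_right (indep_of_far hW hm hi) (comap_le_iSup ⟨hj, hij⟩)

lemma indepFun_triple_of_far (hW : ∀ i, 1 ≤ i → Measurable (W i)) (hm : MDependent P m W)
    {i j k l : ℕ} (hi : 1 ≤ i) (hj : 1 ≤ j) (hk : 1 ≤ k) (hl : 1 ≤ l)
    (hij : j + m < i ∨ i + m < j) (hik : k + m < i ∨ i + m < k) (hil : l + m < i ∨ i + m < l) :
    IndepFun (W i) (fun ω => (W j ω, W k ω, W l ω)) P := by
  rw [IndepFun_iff_Indep]
  refine indep_of_indep_of_le_right (indep_of_far hW hm hi) ?_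
  have h : ∀ a, 1 ≤ a → (a + m < i ∨ i + m < a) →
      Measurable[sigmaGen W {a | 1 ≤ a ∧ (a + m < i ∨ i + m < a)}] (W a) :=
    fun a ha hai => measurable_iff_comap_le.2 (comap_le_iSup ⟨ha, hai⟩)
  exact measurable_iff_comap_le.1 ((h j hj hij).prodMk ((h k hk hik).prodMk (h l hl hil)))

end Independence

/-- The joint law is a product, so by Fubini `A` may be averaged first with `B` frozen. This is how
degeneracy of the kernel kills mixed moments. -/
lemma integral_eq_zero_of_indepFun {Ω α β : Type*} [MeasurableSpace Ω] [MeasurableSpace α]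
    [MeasurableSpace β] {P : Measure Ω} [IsProbabilityMeasure P] {A : Ω → α} {B : Ω → β}
    (hA : Measurable A) (hB : Measurable B) (h : IndepFun A B P) {φ : α → β → ℝ}
    (hφ : Measurable (Function.uncurry φ)) {C : ℝ} (hC : ∀ a b, |φ a b| ≤ C)
    (h0 : ∀ b, ∫ a, φ a b ∂(P.map A) = 0) : ∫ ω, φ (A ω) (B ω) ∂P = 0 := by
  have : IsProbabilityMeasure (P.map A) := Measure.isProbabilityMeasure_map hA.aemeasurable
  have : IsProbabilityMeasure (P.map B) := Measure.isProbabilityMeasure_map hB.aemeasurable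
  have h1 : ∫ ω, φ (A ω) (B ω) ∂P = ∫ p, φ p.1 p.2 ∂(P.map fun ω => (A ω, B ω)) := by
    exact (integral_map (hA.prodMk hB).aemeasurable
      (f := fun p : α × β => φ p.1 p.2) hφ.aestronglyMeasurable).symm
  rw [h1, h.map_prod_eq_prod_map_map hA.aemeasurable hB.aemeasurable, integral_prod_symm]
  · simp [h0]
  · exact Integrable.of_bound hφ.aestronglyMeasurable C (Eventually.of_forall fun p => hC p.1 p.2)

/-! ### Consequences of stationarity, and passage to measurable images. -/

section Transfer

variable {Ω S T : Type*} [MeasurableSpace Ω] [MeasurableSpace S] [MeasurableSpace T]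
  {P : Measure Ω} {m : ℕ} {W : ℕ → Ω → S}

lemma StrictlyStationary.comp (h : StrictlyStationary P W) (hW : ∀ i, 1 ≤ i → Measurable (W i))
    {φ : S → T} (hφ : Measurable φ) : StrictlyStationary P fun i ω => φ (W i ω) := by
  intro r t ht k
  have hΦ : Measurable fun (v : Fin r → S) i => φ (v i) := by fun_prop
  have h1 := congrArg (Measure.map fun (v : Fin r → S) i => φ (v i)) (h r t ht k)
  rw [Measure.map_map hΦ (measurable_pi_lambda _ fun i => hW _ (by have := ht i; omega)),
    Measure.map_map hΦ (measurable_pi_lambda _ fun i => hW _ (ht i))] at h1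
  exact h1

lemma MDependent.comp (h : MDependent P m W) {φ : S → T} (hφ : Measurable φ) :
    MDependent P m fun i ω => φ (W i ω) := by
  intro b k l hb hk hl hmk
  exact (h b k l hb hk hl hmk).comp
    (φ := fun v i => φ (v i)) (ψ := fun v i => φ (v i)) (by fun_prop) (by fun_prop)

lemma StrictlyStationary.map_eq (h : StrictlyStationary P W)
    (hW : ∀ i, 1 ≤ i → Measurable (W i)) {i : ℕ} (hi : 1 ≤ i) :
    P.map (W i) = P.map (W 1) := by
  have h1 := congrArg (Measure.map fun v : Fin 1 → S => v 0)
    (h 1 (fun _ => 1) (fun _ => le_rfl) (i - 1))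
  rw [Measure.map_map (by fun_prop) (measurable_pi_lambda _ fun _ => hW _ (by omega)),
    Measure.map_map (by fun_prop) (measurable_pi_lambda _ fun _ => hW _ le_rfl)] at h1
  rw [show i = 1 + (i - 1) by omega]
  exact h1

lemma StrictlyStationary.map_pair_eq (h : StrictlyStationary P W)
    (hW : ∀ i, 1 ≤ i → Measurable (W i)) {s t : ℕ} (hs : 1 ≤ s) (ht : 1 ≤ t) (k : ℕ) :
    P.map (fun ω => (W (s + k) ω, W (t + k) ω)) = P.map fun ω => (W s ω, W t ω) := by
  have hst : ∀ i, 1 ≤ ![s, t] i := by intro i; fin_cases i <;> assumption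
  have h1 := congrArg (Measure.map fun v : Fin 2 → S => (v 0, v 1)) (h 2 ![s, t] hst k)
  rw [Measure.map_map (by fun_prop) (measurable_pi_lambda _ fun i => hW _ (by
      have := hst i; omega)),
    Measure.map_map (by fun_prop) (measurable_pi_lambda _ fun i => hW _ (hst i))] at h1
  exact h1

end Transfer

/-! ### Second moments of sums of stationary `m`-dependent variables. -/

section SecondMoment

variable {Ω : Type*} [MeasurableSpace Ω] {P : Measure Ω} {m : ℕ} {Z : ℕ → Ω → ℝ} {γ : ℕ → ℝ}

lemma memLp_sum_Icc (hZ : ∀ i, 1 ≤ i → MemLp (Z i) 2 P) (n : ℕ) :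
    MemLp (fun ω => ∑ i ∈ Finset.Icc 1 n, Z i ω) 2 P :=
  memLp_finsetSum _ fun i hi => hZ i (Finset.mem_Icc.1 hi).1

/-- Going from `n` to `n + 1` summands adds one square and the lags `1, …, n`. Written this way,
division by `n` produces a Cesàro mean. -/
lemma integral_sum_sq_eq (hZ : ∀ i, 1 ≤ i → MemLp (Z i) 2 P)
    (hγ : ∀ i h, 1 ≤ i → ∫ ω, Z i ω * Z (i + h) ω ∂P = γ h) (n : ℕ) :
    ∫ ω, (∑ i ∈ Finset.Icc 1 n, Z i ω) ^ 2 ∂P =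
      ∑ k ∈ Finset.range n, (γ 0 + 2 * ∑ h ∈ Finset.Icc 1 k, γ h) := by
  induction n with
  | zero => simp
  | succ n ih =>
    have h0 := memLp_sum_Icc hZ n
    have h1 := hZ (n + 1) (by omega)
    have e1 : ∀ ω, (∑ i ∈ Finset.Icc 1 (n + 1), Z i ω) ^ 2 =
        (∑ i ∈ Finset.Icc 1 n, Z i ω) ^ 2 +
          (Z (n + 1) ω * Z (n + 1 + 0) ω + 2 * ∑ i ∈ Finset.Icc 1 n, Z i ω * Z (n + 1) ω) := by
      intro ω
      rw [Finset.sum_Icc_succ_top (by omega), ← Finset.sum_mul, add_zero]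
      ring
    have i1 : Integrable (fun ω => (∑ i ∈ Finset.Icc 1 n, Z i ω) ^ 2) P := h0.integrable_sq
    have i2 : Integrable (fun ω => Z (n + 1) ω * Z (n + 1 + 0) ω) P := h1.integrable_mul h1
    have i3 : ∀ i ∈ Finset.Icc 1 n, Integrable (fun ω => Z i ω * Z (n + 1) ω) P :=
      fun i hi => (hZ i (Finset.mem_Icc.1 hi).1).integrable_mul h1
    have i4 : Integrable (fun ω => 2 * ∑ i ∈ Finset.Icc 1 n, Z i ω * Z (n + 1) ω) P :=
      (integrable_finsetSum _ i3).const_mul 2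
    have i5 : Integrable (fun ω => Z (n + 1) ω * Z (n + 1 + 0) ω +
        2 * ∑ i ∈ Finset.Icc 1 n, Z i ω * Z (n + 1) ω) P := i2.add i4
    simp_rw [e1]
    rw [integral_add i1 i5, integral_add i2 i4, integral_const_mul, integral_finsetSum _ i3, ih,
      hγ _ _ (by omega), Finset.sum_range_succ]
    congr 3
    -- Reindex the cross terms by the lag to the new index `n + 1`.
    refine Finset.sum_nbij' (fun i => n + 1 - i) (fun i => n + 1 - i) ?_ ?_ ?_ ?_ ?_
    · intro i hi; simp only [Finset.mem_Icc] at hi ⊢; omega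
    · intro i hi; simp only [Finset.mem_Icc] at hi ⊢; omega
    · intro i hi; simp only [Finset.mem_Icc] at hi ⊢; omega
    · intro i hi; simp only [Finset.mem_Icc] at hi ⊢; omega
    · intro i hi
      simp only [Finset.mem_Icc] at hi
      rw [← hγ i (n + 1 - i) hi.1, show i + (n + 1 - i) = n + 1 by omega]

/-- A Cesàro mean of a sequence that is constant from `m` on. -/
lemma tendsto_integral_sum_sq_div (hZ : ∀ i, 1 ≤ i → MemLp (Z i) 2 P)
    (hγ : ∀ i h, 1 ≤ i → ∫ ω, Z i ω * Z (i + h) ω ∂P = γ h) (hγm : ∀ h, m < h → γ h = 0) :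
    Tendsto (fun n : ℕ => (∫ ω, (∑ i ∈ Finset.Icc 1 n, Z i ω) ^ 2 ∂P) / n) atTop
      (𝓝 (γ 0 + 2 * ∑ h ∈ Finset.Icc 1 m, γ h)) := by
  have h1 : Tendsto (fun k => γ 0 + 2 * ∑ h ∈ Finset.Icc 1 k, γ h) atTop
      (𝓝 (γ 0 + 2 * ∑ h ∈ Finset.Icc 1 m, γ h)) := by
    refine tendsto_const_nhds.congr' ?_
    filter_upwards [eventually_ge_atTop m] with k hk
    rw [Finset.sum_subset (Finset.Icc_subset_Icc_right hk)]
    intro x _ hx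
    refine hγm x ?_
    simp only [Finset.mem_Icc] at *
    omega
  refine h1.cesaro.congr fun n => ?_
  rw [integral_sum_sq_eq hZ hγ, div_eq_inv_mul]

lemma abs_integral_mul_le_half {u v : Ω → ℝ} (hu : MemLp u 2 P) (hv : MemLp v 2 P) :
    |∫ ω, u ω * v ω ∂P| ≤ ((∫ ω, u ω ^ 2 ∂P) + ∫ ω, v ω ^ 2 ∂P) / 2 := by
  calc |∫ ω, u ω * v ω ∂P| ≤ ∫ ω, |u ω * v ω| ∂P := abs_integral_le_integral_abs
    _ ≤ ∫ ω, (u ω ^ 2 + v ω ^ 2) / 2 ∂P := by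
      refine integral_mono_of_nonneg (Eventually.of_forall fun x => abs_nonneg _)
        ((hu.integrable_sq.add hv.integrable_sq).div_const 2) (Eventually.of_forall fun x => ?_)
      simp only [abs_mul]
      nlinarith [sq_nonneg (|u x| - |v x|), sq_abs (u x), sq_abs (v x)]
    _ = _ := by rw [integral_div, integral_add hu.integrable_sq hv.integrable_sq]

/-- Every lag covariance is at most `γ 0`, and at most `m` positive lags survive. The bound holds
for every `n`, which is needed for summands that change with `ε`. -/
lemma integral_sum_sq_le (hZ : ∀ i, 1 ≤ i → MemLp (Z i) 2 P)
    (hγ : ∀ i h, 1 ≤ i → ∫ ω, Z i ω * Z (i + h) ω ∂P = γ h) (hγm : ∀ h, m < h → γ h = 0) (n : ℕ) :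
    ∫ ω, (∑ i ∈ Finset.Icc 1 n, Z i ω) ^ 2 ∂P ≤ n * ((2 * m + 1) * γ 0) := by
  have hsq : ∀ i, 1 ≤ i → ∫ ω, Z i ω ^ 2 ∂P = γ 0 := by
    intro i hi
    simpa [sq] using hγ i 0 hi
  have h0 : 0 ≤ γ 0 := by
    rw [← hsq 1 le_rfl]
    exact integral_nonneg fun ω => sq_nonneg _
  have hle : ∀ h, γ h ≤ γ 0 := by
    intro h
    have := abs_integral_mul_le_half (hZ 1 le_rfl) (hZ (1 + h) (by omega))
    rw [hγ 1 h le_rfl, hsq 1 le_rfl, hsq (1 + h) (by omega)] at this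
    linarith [le_abs_self (γ h)]
  have hs : ∀ k, ∑ h ∈ Finset.Icc 1 k, γ h ≤ m * γ 0 := by
    intro k
    calc ∑ h ∈ Finset.Icc 1 k, γ h ≤ ∑ h ∈ Finset.Icc 1 m, γ 0 := by
          rw [← Finset.sum_filter_add_sum_filter_not (Finset.Icc 1 k) (· ≤ m)]
          have e : ∑ h ∈ (Finset.Icc 1 k).filter (fun h => ¬ h ≤ m), γ h = 0 :=
            Finset.sum_eq_zero fun h hh => hγm h (by simpa using (Finset.mem_filter.1 hh).2)
          rw [e, add_zero]
          refine (Finset.sum_le_sum fun h _ => hle h).trans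
            (Finset.sum_le_sum_of_subset_of_nonneg ?_ fun _ _ _ => h0)
          intro h hh
          simp only [Finset.mem_filter, Finset.mem_Icc] at *
          omega
      _ = m * γ 0 := by simp
  rw [integral_sum_sq_eq hZ hγ]
  calc _ ≤ ∑ k ∈ Finset.range n, ((2 * m + 1) * γ 0) :=
        Finset.sum_le_sum fun k _ => by linarith [hs k]
    _ = _ := by simp

end SecondMoment

lemma longRunVar_eq {Ω S : Type*} [MeasurableSpace Ω] {P : Measure Ω} {m : ℕ} {W : ℕ → Ω → S}
    {φ : S → ℝ} (hφ : AEMeasurable (fun ω => φ (W 1 ω)) P) :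
    longRunVar P m (fun i ω => φ (W i ω)) =
      covariance (fun ω => φ (W 1 ω)) (fun ω => φ (W (1 + 0) ω)) P +
      2 * ∑ h ∈ Finset.Icc 1 m,
        covariance (fun ω => φ (W 1 ω)) (fun ω => φ (W (1 + h) ω)) P := by
  rw [longRunVar, add_zero, covariance_self hφ]

section Centered

variable {Ω S : Type*} [MeasurableSpace Ω] [MeasurableSpace S] {P : Measure Ω}
  {m : ℕ} {W : ℕ → Ω → S} {φ : S → ℝ}

lemma covariance_eq_integral_centered (hW : ∀ i, 1 ≤ i → Measurable (W i))
    (hs : StrictlyStationary P W) (hφ : Measurable φ) {i j : ℕ} (hi : 1 ≤ i) (hj : 1 ≤ j) :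
    covariance (fun ω => φ (W i ω)) (fun ω => φ (W j ω)) P =
      ∫ ω, (φ (W i ω) - ∫ ω, φ (W 1 ω) ∂P) * (φ (W j ω) - ∫ ω, φ (W 1 ω) ∂P) ∂P := by
  have h : ∀ i, 1 ≤ i → ∫ ω, φ (W i ω) ∂P = ∫ ω, φ (W 1 ω) ∂P := by
    intro i hi
    rw [← integral_map (hW i hi).aemeasurable hφ.aestronglyMeasurable, hs.map_eq hW hi,
      integral_map (hW 1 le_rfl).aemeasurable hφ.aestronglyMeasurable]
  rw [covariance, h i hi, h j hj]

lemma memLp_comp_stationary (hW : ∀ i, 1 ≤ i → Measurable (W i))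
    (hs : StrictlyStationary P W) (hφ : Measurable φ) {p : ENNReal}
    (h2 : MemLp (fun ω => φ (W 1 ω)) p P) {i : ℕ} (hi : 1 ≤ i) :
    MemLp (fun ω => φ (W i ω)) p P := by
  have h1 : MemLp φ p (P.map (W 1)) :=
    (memLp_map_measure_iff hφ.aestronglyMeasurable (hW 1 le_rfl).aemeasurable).2 h2
  rw [← hs.map_eq hW hi] at h1
  exact (memLp_map_measure_iff hφ.aestronglyMeasurable (hW i hi).aemeasurable).1 h1

lemma covariance_shift (hW : ∀ i, 1 ≤ i → Measurable (W i))
    (hs : StrictlyStationary P W) (hφ : Measurable φ) {i : ℕ} (hi : 1 ≤ i) (h : ℕ) :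
    ∫ ω, (φ (W i ω) - ∫ ω, φ (W 1 ω) ∂P) * (φ (W (i + h) ω) - ∫ ω, φ (W 1 ω) ∂P) ∂P =
      covariance (fun ω => φ (W 1 ω)) (fun ω => φ (W (1 + h) ω)) P := by
  rw [covariance_eq_integral_centered hW hs hφ le_rfl (by omega)]
  set c := ∫ ω, φ (W 1 ω) ∂P with hc
  have hm : Measurable fun p : S × S => (φ p.1 - c) * (φ p.2 - c) := by fun_prop
  have h1 := hs.map_pair_eq hW (le_refl 1) (show 1 ≤ 1 + h by omega) (i - 1)
  have h2 := congrArg (fun ρ => ∫ p, (φ p.1 - c) * (φ p.2 - c) ∂ρ) h1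
  beta_reduce at h2
  rw [integral_map ((hW _ (by omega)).prodMk (hW _ (by omega))).aemeasurable
      hm.aestronglyMeasurable,
    integral_map ((hW _ (by omega)).prodMk (hW _ (by omega))).aemeasurable
      hm.aestronglyMeasurable] at h2
  rw [← h2, show 1 + (i - 1) = i by omega, show 1 + h + (i - 1) = i + h by omega]

variable [IsProbabilityMeasure P]

lemma covariance_eq_zero_of_lt (hW : ∀ i, 1 ≤ i → Measurable (W i))
    (hm : MDependent P m W) (hφ : Measurable φ) (hs : StrictlyStationary P W)
    (h2 : MemLp (fun ω => φ (W 1 ω)) 2 P) {h : ℕ} (hh : m < h) :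
    covariance (fun ω => φ (W 1 ω)) (fun ω => φ (W (1 + h) ω)) P = 0 :=
  ((indepFun_of_far hW hm le_rfl (show 1 ≤ 1 + h by omega) (by omega)).comp hφ hφ).covariance_eq_zero
    h2 (memLp_comp_stationary hW hs hφ h2 (by omega))

/-- Law of large numbers in mean square, with the exact first order term. -/
lemma tendsto_integral_centered_sum_sq_div (hW : ∀ i, 1 ≤ i → Measurable (W i))
    (hs : StrictlyStationary P W) (hm : MDependent P m W) (hφ : Measurable φ)
    (h2 : MemLp (fun ω => φ (W 1 ω)) 2 P) :
    Tendsto (fun n : ℕ =>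
      (∫ ω, (∑ i ∈ Finset.Icc 1 n, (φ (W i ω) - ∫ ω, φ (W 1 ω) ∂P)) ^ 2 ∂P) / n) atTop
      (𝓝 (longRunVar P m fun i ω => φ (W i ω))) := by
  rw [longRunVar_eq h2.aestronglyMeasurable.aemeasurable]
  exact tendsto_integral_sum_sq_div
    (fun i hi => (memLp_comp_stationary hW hs hφ h2 hi).sub (memLp_const _))
    (fun i h hi => covariance_shift hW hs hφ hi h)
    (fun h hh => covariance_eq_zero_of_lt hW hm hφ hs h2 hh)

lemma integral_centered_sum_sq_le (hW : ∀ i, 1 ≤ i → Measurable (W i))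
    (hs : StrictlyStationary P W) (hm : MDependent P m W) (hφ : Measurable φ)
    (h2 : MemLp (fun ω => φ (W 1 ω)) 2 P) (n : ℕ) :
    ∫ ω, (∑ i ∈ Finset.Icc 1 n, (φ (W i ω) - ∫ ω, φ (W 1 ω) ∂P)) ^ 2 ∂P ≤
      n * ((2 * m + 1) * variance (fun ω => φ (W 1 ω)) P) := by
  rw [← covariance_self h2.aestronglyMeasurable.aemeasurable]
  exact integral_sum_sq_le
    (fun i hi => (memLp_comp_stationary hW hs hφ h2 hi).sub (memLp_const _))
    (fun i h hi => covariance_shift hW hs hφ hi h)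
    (fun h hh => covariance_eq_zero_of_lt hW hm hφ hs h2 hh) n

end Centered

/-! ### The common model of both statistics and its degenerate kernel. -/

/-- A strictly stationary `m`-dependent sequence of pairs `(U i, V i)`, `i ≥ 1`, whose marginals
have the cubically integrable densities `f` and `g`. -/
structure PairModel {Ω : Type*} [MeasurableSpace Ω] (P : Measure Ω) {d : ℕ} (m : ℕ)
    (U V : ℕ → Ω → EuclideanSpace ℝ (Fin d)) (f g : EuclideanSpace ℝ (Fin d) → ℝ) : Prop where
  measU : ∀ i, 1 ≤ i → Measurable (U i)
  measV : ∀ i, 1 ≤ i → Measurable (V i)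
  densU : IsDensity P (U 1) f
  densV : IsDensity P (V 1) g
  memU : MemLp f 3 volume
  memV : MemLp g 3 volume
  stat : StrictlyStationary P fun i ω => (U i ω, V i ω)
  mdep : MDependent P m fun i ω => (U i ω, V i ω)

/-- The mean of `smooth ε g` under the density `f`. -/
noncomputable def smoothMean {d : ℕ} (ε : ℝ) (f g : EuclideanSpace ℝ (Fin d) → ℝ) : ℝ :=
  ∫ x, f x * smooth ε g x

/-- The completely degenerate part of the normalised kernel `close ε x y / ballVol d ε`. -/
noncomputable def resid {d : ℕ} (ε : ℝ) (f g : EuclideanSpace ℝ (Fin d) → ℝ)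
    (x y : EuclideanSpace ℝ (Fin d)) : ℝ :=
  close ε x y / ballVol d ε - smooth ε g x - smooth ε f y + smoothMean ε f g

namespace PairModel

variable {Ω : Type*} [MeasurableSpace Ω] {P : Measure Ω} {d m : ℕ}
  {U V : ℕ → Ω → EuclideanSpace ℝ (Fin d)} {f g : EuclideanSpace ℝ (Fin d) → ℝ} {ε : ℝ}

lemma measW (M : PairModel P m U V f g) {i : ℕ} (hi : 1 ≤ i) :
    Measurable fun ω => (U i ω, V i ω) :=
  (M.measU i hi).prodMk (M.measV i hi)

lemma measf (M : PairModel P m U V f g) : Measurable f := M.densU.1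

lemma measg (M : PairModel P m U V f g) : Measurable g := M.densV.1

lemma f_nonneg (M : PairModel P m U V f g) (x : EuclideanSpace ℝ (Fin d)) : 0 ≤ f x :=
  M.densU.2.1 x

lemma g_nonneg (M : PairModel P m U V f g) (x : EuclideanSpace ℝ (Fin d)) : 0 ≤ g x :=
  M.densV.2.1 x

lemma mapU (M : PairModel P m U V f g) {i : ℕ} (hi : 1 ≤ i) : P.map (U i) = P.map (U 1) :=
  (M.stat.comp (fun _ => M.measW) measurable_fst).map_eq M.measU hi

lemma mapV (M : PairModel P m U V f g) {i : ℕ} (hi : 1 ≤ i) : P.map (V i) = P.map (V 1) :=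
  (M.stat.comp (fun _ => M.measW) measurable_snd).map_eq M.measV hi

lemma smoothMean_eq_left (M : PairModel P m U V f g) :
    smoothMean ε f g = ∫ x, smooth ε g x ∂(P.map (U 1)) :=
  (integral_of_density M.measf M.f_nonneg M.densU.2.2 _).symm

lemma smoothMean_nonneg (M : PairModel P m U V f g) : 0 ≤ smoothMean ε f g :=
  integral_nonneg fun x => mul_nonneg (M.f_nonneg x) (smooth_nonneg M.g_nonneg x)

lemma measurable_resid (M : PairModel P m U V f g) :
    Measurable fun p : EuclideanSpace ℝ (Fin d) × EuclideanSpace ℝ (Fin d) =>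
      resid ε f g p.1 p.2 := by
  have h1 := M.measf
  have h2 := M.measg
  unfold resid
  fun_prop

lemma measurable_resid_comp (M : PairModel P m U V f g) {α : Type*} [MeasurableSpace α]
    {u v : α → EuclideanSpace ℝ (Fin d)} (hu : Measurable u) (hv : Measurable v) :
    Measurable fun a => resid ε f g (u a) (v a) := by
  have h := (M.measurable_resid (ε := ε)).comp (hu.prodMk hv)
  exact h

variable [IsProbabilityMeasure P]

lemma isProb_U (M : PairModel P m U V f g) : IsProbabilityMeasure (P.map (U 1)) :=
  Measure.isProbabilityMeasure_map (M.measU 1 le_rfl).aemeasurable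

lemma isProb_V (M : PairModel P m U V f g) : IsProbabilityMeasure (P.map (V 1)) :=
  Measure.isProbabilityMeasure_map (M.measV 1 le_rfl).aemeasurable

lemma integrable_f (M : PairModel P m U V f g) : Integrable f :=
  have := M.isProb_U
  integrable_density M.measf M.f_nonneg M.densU.2.2

lemma integrable_g (M : PairModel P m U V f g) : Integrable g :=
  have := M.isProb_V
  integrable_density M.measg M.g_nonneg M.densV.2.2

lemma smooth_g_le (M : PairModel P m U V f g) (x : EuclideanSpace ℝ (Fin d)) :
    smooth ε g x ≤ 1 / ballVol d ε := by
  have := M.isProb_V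
  rw [← integral_density M.measg M.g_nonneg M.densV.2.2]
  exact smooth_le M.g_nonneg M.integrable_g x

lemma smooth_f_le (M : PairModel P m U V f g) (x : EuclideanSpace ℝ (Fin d)) :
    smooth ε f x ≤ 1 / ballVol d ε := by
  have := M.isProb_U
  rw [← integral_density M.measf M.f_nonneg M.densU.2.2]
  exact smooth_le M.f_nonneg M.integrable_f x

/-- Fubini and the symmetry of the kernel. Since both one-variable averages have the same mean, one
constant centres `resid` in either argument. -/
lemma smoothMean_eq_right (M : PairModel P m U V f g) :
    smoothMean ε f g = ∫ y, smooth ε f y ∂(P.map (V 1)) := by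
  have := M.isProb_U
  have := M.isProb_V
  rw [M.smoothMean_eq_left]
  simp_rw [smooth_eq_integral M.measg M.g_nonneg M.densV.2.2,
    smooth_eq_integral M.measf M.f_nonneg M.densU.2.2]
  rw [integral_div, integral_div, integral_integral_swap]
  · simp_rw [close_comm]
  · refine Integrable.of_bound (C := 1) (Measurable.aestronglyMeasurable ?_)
      (Eventually.of_forall fun p => ?_)
    · unfold Function.uncurry; fun_prop
    · simp only [Function.uncurry]
      rw [Real.norm_of_nonneg (close_nonneg _ _)]
      exact close_le_one _ _

lemma smoothMean_le (M : PairModel P m U V f g) : smoothMean ε f g ≤ 1 / ballVol d ε := by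
  have := M.isProb_U
  rw [M.smoothMean_eq_left]
  calc _ ≤ ∫ _, 1 / ballVol d ε ∂(P.map (U 1)) :=
        integral_mono ((memLp_smooth M.measg M.g_nonneg M.integrable_g 1).integrable le_rfl)
          (integrable_const _) fun x => M.smooth_g_le x
    _ = _ := by simp

lemma abs_resid_le (M : PairModel P m U V f g) (hε : 0 < ε) (x y : EuclideanSpace ℝ (Fin d)) :
    |resid ε f g x y| ≤ 2 / ballVol d ε := by
  have hb := ballVol_pos (d := d) hε
  have h1 : close ε x y / ballVol d ε ≤ 1 / ballVol d ε :=
    div_le_div_of_nonneg_right (close_le_one _ _) hb.le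
  have h2 : 0 ≤ close ε x y / ballVol d ε := div_nonneg (close_nonneg _ _) hb.le
  have h3 := M.smooth_g_le (ε := ε) x
  have h4 := M.smooth_f_le (ε := ε) y
  have h5 := M.smoothMean_le (ε := ε)
  have h6 := M.smoothMean_nonneg (ε := ε)
  have h7 := smooth_nonneg (ε := ε) M.g_nonneg x
  have h8 := smooth_nonneg (ε := ε) M.f_nonneg y
  have h9 : 2 / ballVol d ε = 1 / ballVol d ε + 1 / ballVol d ε := by ring
  rw [resid, abs_le, h9]
  constructor <;> linarith

lemma integrable_close_comp {μ : Measure (EuclideanSpace ℝ (Fin d))} [IsFiniteMeasure μ]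
    (y : EuclideanSpace ℝ (Fin d)) : Integrable (fun x => close ε y x) μ :=
  Integrable.of_bound (C := 1) (by fun_prop) (Eventually.of_forall fun x => by
    rw [Real.norm_of_nonneg (close_nonneg _ _)]
    exact close_le_one _ _)

/-- Averaging the normalised kernel over `x` gives `smooth ε f y`, and averaging `smooth ε g` gives
`smoothMean ε f g`, so the four terms cancel in pairs. -/
lemma integral_resid_left (M : PairModel P m U V f g) (y : EuclideanSpace ℝ (Fin d)) :
    ∫ x, resid ε f g x y ∂(P.map (U 1)) = 0 := by
  have := M.isProb_U
  have h1 : Integrable (fun x => close ε x y / ballVol d ε) (P.map (U 1)) := by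
    simp_rw [close_comm _ y]
    exact (integrable_close_comp y).div_const _
  have h2 : Integrable (smooth ε g) (P.map (U 1)) :=
    (memLp_smooth M.measg M.g_nonneg M.integrable_g 1).integrable le_rfl
  have h3 : Integrable (fun x => close ε x y / ballVol d ε - smooth ε g x) (P.map (U 1)) :=
    h1.sub h2
  have h4 : Integrable (fun x => close ε x y / ballVol d ε - smooth ε g x - smooth ε f y)
      (P.map (U 1)) := h3.sub (integrable_const _)
  unfold resid
  rw [integral_add h4 (integrable_const _), integral_sub h3 (integrable_const _),
    integral_sub h1 h2, integral_div, ← M.smoothMean_eq_left,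
    smooth_eq_integral M.measf M.f_nonneg M.densU.2.2]
  simp_rw [close_comm _ y]
  simp

lemma integral_resid_right (M : PairModel P m U V f g) (x : EuclideanSpace ℝ (Fin d)) :
    ∫ y, resid ε f g x y ∂(P.map (V 1)) = 0 := by
  have := M.isProb_V
  have h1 : Integrable (fun y => close ε x y / ballVol d ε) (P.map (V 1)) :=
    (integrable_close_comp x).div_const _
  have h2 : Integrable (smooth ε f) (P.map (V 1)) :=
    (memLp_smooth M.measf M.f_nonneg M.integrable_f 1).integrable le_rfl
  have h3 : Integrable (fun y => close ε x y / ballVol d ε - smooth ε g x) (P.map (V 1)) :=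
    h1.sub (integrable_const _)
  have h4 : Integrable (fun y => close ε x y / ballVol d ε - smooth ε g x - smooth ε f y)
      (P.map (V 1)) := h3.sub h2
  unfold resid
  rw [integral_add h4 (integrable_const _), integral_sub h3 h2,
    integral_sub h1 (integrable_const _), integral_div, ← M.smoothMean_eq_right,
    smooth_eq_integral M.measg M.g_nonneg M.densV.2.2]
  simp

/-! ### Vanishing mixed moments and the counting of index quadruples. -/

/-- The index `i` is more than `m` apart from each of `j`, `k`, `l`. -/
def Isolated (m i j k l : ℕ) : Prop :=
  (j + m < i ∨ i + m < j) ∧ (k + m < i ∨ i + m < k) ∧ (l + m < i ∨ i + m < l)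

lemma abs_resid_mul_le (M : PairModel P m U V f g) (hε : 0 < ε)
    (x y x' y' : EuclideanSpace ℝ (Fin d)) :
    |resid ε f g x y * resid ε f g x' y'| ≤ 2 / ballVol d ε * (2 / ballVol d ε) := by
  have hb := ballVol_pos (d := d) hε
  rw [abs_mul]
  exact mul_le_mul (M.abs_resid_le hε _ _) (M.abs_resid_le hε _ _) (abs_nonneg _) (by positivity)

lemma integral_resid_mul_eq_zero_left (M : PairModel P m U V f g) (hε : 0 < ε) {i j k l : ℕ}
    (hi : 1 ≤ i) (hj : 1 ≤ j) (hk : 1 ≤ k) (hl : 1 ≤ l) (h : Isolated m i j k l) :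
    ∫ ω, resid ε f g (U i ω) (V j ω) * resid ε f g (U k ω) (V l ω) ∂P = 0 := by
  have h1 := indepFun_triple_of_far (fun _ => M.measW) M.mdep hi hj hk hl h.1 h.2.1 h.2.2
  have h2 := h1.comp (φ := Prod.fst) (ψ := fun p => (p.1.2, p.2.1.1, p.2.2.2))
    measurable_fst (by fun_prop)
  refine integral_eq_zero_of_indepFun (A := U i) (B := fun ω => (V j ω, U k ω, V l ω))
    (φ := fun a b => resid ε f g a b.1 * resid ε f g b.2.1 b.2.2) (M.measU i hi)
    ((M.measV j hj).prodMk ((M.measU k hk).prodMk (M.measV l hl))) h2 ?_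
    (fun a b => M.abs_resid_mul_le hε _ _ _ _) ?_
  · exact (M.measurable_resid_comp (by fun_prop) (by fun_prop)).mul
      (M.measurable_resid_comp (by fun_prop) (by fun_prop))
  · intro b
    rw [integral_mul_const, M.mapU hi, M.integral_resid_left, zero_mul]

lemma integral_resid_mul_eq_zero_right (M : PairModel P m U V f g) (hε : 0 < ε) {i j k l : ℕ}
    (hi : 1 ≤ i) (hj : 1 ≤ j) (hk : 1 ≤ k) (hl : 1 ≤ l) (h : Isolated m j i k l) :
    ∫ ω, resid ε f g (U i ω) (V j ω) * resid ε f g (U k ω) (V l ω) ∂P = 0 := by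
  have h1 := indepFun_triple_of_far (fun _ => M.measW) M.mdep hj hi hk hl h.1 h.2.1 h.2.2
  have h2 := h1.comp (φ := Prod.snd) (ψ := fun p => (p.1.1, p.2.1.1, p.2.2.2))
    measurable_snd (by fun_prop)
  refine integral_eq_zero_of_indepFun (A := V j) (B := fun ω => (U i ω, U k ω, V l ω))
    (φ := fun a b => resid ε f g b.1 a * resid ε f g b.2.1 b.2.2) (M.measV j hj)
    ((M.measU i hi).prodMk ((M.measU k hk).prodMk (M.measV l hl))) h2 ?_
    (fun a b => M.abs_resid_mul_le hε _ _ _ _) ?_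
  · exact (M.measurable_resid_comp (by fun_prop) (by fun_prop)).mul
      (M.measurable_resid_comp (by fun_prop) (by fun_prop))
  · intro b
    rw [integral_mul_const, M.mapV hj, M.integral_resid_right, zero_mul]

lemma integral_resid_mul_eq_zero (M : PairModel P m U V f g) (hε : 0 < ε) {i j k l : ℕ}
    (hi : 1 ≤ i) (hj : 1 ≤ j) (hk : 1 ≤ k) (hl : 1 ≤ l)
    (h : Isolated m i j k l ∨ Isolated m j i k l ∨ Isolated m k l i j ∨ Isolated m l k i j) :
    ∫ ω, resid ε f g (U i ω) (V j ω) * resid ε f g (U k ω) (V l ω) ∂P = 0 := by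
  rcases h with h | h | h | h
  · exact M.integral_resid_mul_eq_zero_left hε hi hj hk hl h
  · exact M.integral_resid_mul_eq_zero_right hε hi hj hk hl h
  · simp_rw [mul_comm (resid ε f g (U i _) _)]
    exact M.integral_resid_mul_eq_zero_left hε hk hl hi hj h
  · simp_rw [mul_comm (resid ε f g (U i _) _)]
    exact M.integral_resid_mul_eq_zero_right hε hk hl hi hj h

/-- Indicator of `|i - j| ≤ 2 m`. -/
def near (m i j : ℕ) : ℝ := if i ≤ j + 2 * m ∧ j ≤ i + 2 * m then 1 else 0

lemma near_nonneg (m i j : ℕ) : 0 ≤ near m i j := by unfold near; split_ifs <;> norm_num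

lemma near_eq_one {m i j : ℕ} (h : i ≤ j + 2 * m ∧ j ≤ i + 2 * m) : near m i j = 1 := if_pos h

/-- Join two of the four indices when they are at distance at most `m`. A graph on four vertices
without isolated vertex contains a perfect matching or is a star; in a star two leaves are within `2
m` of each other through the centre, whence the window in `near`. -/
lemma exists_near_pairing (m i j k l : ℕ) :
    (Isolated m i j k l ∨ Isolated m j i k l ∨ Isolated m k l i j ∨ Isolated m l k i j) ∨
      1 ≤ near m i j * near m k l + near m i k * near m j l + near m i l * near m j k := by
  by_cases h : Isolated m i j k l ∨ Isolated m j i k l ∨ Isolated m k l i j ∨ Isolated m l k i j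
  · exact Or.inl h
  right
  have key : ((i ≤ j + 2 * m ∧ j ≤ i + 2 * m) ∧ (k ≤ l + 2 * m ∧ l ≤ k + 2 * m)) ∨
      ((i ≤ k + 2 * m ∧ k ≤ i + 2 * m) ∧ (j ≤ l + 2 * m ∧ l ≤ j + 2 * m)) ∨
      ((i ≤ l + 2 * m ∧ l ≤ i + 2 * m) ∧ (j ≤ k + 2 * m ∧ k ≤ j + 2 * m)) := by
    unfold Isolated at h
    omega
  have n1 := mul_nonneg (near_nonneg m i j) (near_nonneg m k l)
  have n2 := mul_nonneg (near_nonneg m i k) (near_nonneg m j l)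
  have n3 := mul_nonneg (near_nonneg m i l) (near_nonneg m j k)
  rcases key with ⟨h1, h2⟩ | ⟨h1, h2⟩ | ⟨h1, h2⟩ <;>
  · rw [near_eq_one h1, near_eq_one h2] at *
    linarith

lemma sum_near_le (m n i : ℕ) : ∑ j ∈ Finset.Icc 1 n, near m i j ≤ 4 * m + 1 := by
  unfold near
  rw [Finset.sum_boole]
  have : ((Finset.Icc 1 n).filter fun j => i ≤ j + 2 * m ∧ j ≤ i + 2 * m) ⊆
      Finset.Icc (i - 2 * m) (i + 2 * m) := by
    intro j hj
    simp only [Finset.mem_filter, Finset.mem_Icc] at *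
    omega
  have h2 := Finset.card_le_card this
  rw [Nat.card_Icc] at h2
  have h3 : ((Finset.Icc 1 n).filter fun j => i ≤ j + 2 * m ∧ j ≤ i + 2 * m).card ≤ 4 * m + 1 := by
    omega
  exact_mod_cast h3

/-- Each of the three pairings leaves two free indices, and the partner of each lies in a window of
`4 m + 1` values. So `O(n²)` of the `n⁴` quadruples matter. -/
lemma sum_near_pairing_le (m n : ℕ) :
    ∑ i ∈ Finset.Icc 1 n, ∑ j ∈ Finset.Icc 1 n, ∑ k ∈ Finset.Icc 1 n, ∑ l ∈ Finset.Icc 1 n,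
      (near m i j * near m k l + near m i k * near m j l + near m i l * near m j k) ≤
      3 * (n * (4 * m + 1)) ^ 2 := by
  set s := Finset.Icc 1 n with hs
  set B : ℝ := 4 * m + 1 with hB
  have hB0 : 0 ≤ B := by positivity
  have hrow : ∀ i, ∑ j ∈ s, near m i j ≤ B := sum_near_le m n
  have hrow0 : ∀ i, 0 ≤ ∑ j ∈ s, near m i j := fun i =>
    Finset.sum_nonneg fun j _ => near_nonneg m i j
  have hcard : (s.card : ℝ) = n := by simp [hs]
  have htot : ∑ i ∈ s, ∑ j ∈ s, near m i j ≤ n * B := by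
    calc _ ≤ ∑ i ∈ s, B := Finset.sum_le_sum fun i _ => hrow i
      _ = _ := by simp [hcard]
  have htot0 : 0 ≤ ∑ i ∈ s, ∑ j ∈ s, near m i j := Finset.sum_nonneg fun i _ => hrow0 i
  simp_rw [Finset.sum_add_distrib]
  have e1 : ∑ i ∈ s, ∑ j ∈ s, ∑ k ∈ s, ∑ l ∈ s, near m i j * near m k l ≤ (n * B) ^ 2 := by
    simp_rw [← Finset.mul_sum, ← Finset.sum_mul]
    rw [sq]
    exact mul_le_mul htot htot htot0 (by positivity)
  have e2 : ∑ i ∈ s, ∑ j ∈ s, ∑ k ∈ s, ∑ l ∈ s, near m i k * near m j l ≤ (n * B) ^ 2 := by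
    calc _ ≤ ∑ i ∈ s, ∑ j ∈ s, B * B := by
          refine Finset.sum_le_sum fun i _ => Finset.sum_le_sum fun j _ => ?_
          simp_rw [← Finset.mul_sum, ← Finset.sum_mul]
          exact mul_le_mul (hrow i) (hrow j) (hrow0 j) hB0
      _ = _ := by simp [hcard]; ring
  have e3 : ∑ i ∈ s, ∑ j ∈ s, ∑ k ∈ s, ∑ l ∈ s, near m i l * near m j k ≤ (n * B) ^ 2 := by
    calc _ ≤ ∑ i ∈ s, ∑ j ∈ s, B * B := by
          refine Finset.sum_le_sum fun i _ => Finset.sum_le_sum fun j _ => ?_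
          simp_rw [← Finset.sum_mul, ← Finset.mul_sum]
          exact mul_le_mul (hrow i) (hrow j) (hrow0 j) hB0
      _ = _ := by simp [hcard]; ring
  linarith

/-- Second moment of the weighted sum of residuals. -/
lemma integral_sum_resid_sq_le (M : PairModel P m U V f g) (hε : 0 < ε) {w : ℕ → ℕ → ℝ}
    (hw : ∀ i j, |w i j| ≤ 1) {D : ℝ}
    (hD : ∀ i j, 1 ≤ i → 1 ≤ j → w i j ≠ 0 → ∫ ω, resid ε f g (U i ω) (V j ω) ^ 2 ∂P ≤ D) (n : ℕ)
    (hD0 : 0 ≤ D) :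
    ∫ ω, (∑ i ∈ Finset.Icc 1 n, ∑ j ∈ Finset.Icc 1 n,
      w i j * resid ε f g (U i ω) (V j ω)) ^ 2 ∂P ≤ 3 * (n * (4 * m + 1)) ^ 2 * D := by
  set s := Finset.Icc 1 n with hs
  have hmem : ∀ i ∈ s, 1 ≤ i := fun i hi => (Finset.mem_Icc.1 hi).1
  have hL2 : ∀ i j, 1 ≤ i → 1 ≤ j → MemLp (fun ω => resid ε f g (U i ω) (V j ω)) 2 P :=
    fun i j hi hj => MemLp.of_bound
      (M.measurable_resid_comp (M.measU i hi) (M.measV j hj)).aestronglyMeasurable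
      (2 / ballVol d ε) (Eventually.of_forall fun ω => M.abs_resid_le hε _ _)
  have hint : ∀ i ∈ s, ∀ j ∈ s, ∀ k ∈ s, ∀ l ∈ s, Integrable (fun ω =>
      w i j * w k l * (resid ε f g (U i ω) (V j ω) * resid ε f g (U k ω) (V l ω))) P :=
    fun i hi j hj k hk l hl => ((hL2 i j (hmem i hi) (hmem j hj)).integrable_mul
      (hL2 k l (hmem k hk) (hmem l hl))).const_mul _
  have e1 : ∀ ω, (∑ i ∈ s, ∑ j ∈ s, w i j * resid ε f g (U i ω) (V j ω)) ^ 2 =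
      ∑ i ∈ s, ∑ j ∈ s, ∑ k ∈ s, ∑ l ∈ s,
        w i j * w k l * (resid ε f g (U i ω) (V j ω) * resid ε f g (U k ω) (V l ω)) := by
    intro ω
    rw [sq, Finset.sum_mul]
    refine Finset.sum_congr rfl fun i _ => ?_
    rw [Finset.sum_mul]
    refine Finset.sum_congr rfl fun j _ => ?_
    rw [Finset.mul_sum]
    refine Finset.sum_congr rfl fun k _ => ?_
    rw [Finset.mul_sum]
    refine Finset.sum_congr rfl fun l _ => ?_
    ring
  simp_rw [e1]
  rw [integral_finsetSum _ fun i hi => integrable_finsetSum _ fun j hj =>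
    integrable_finsetSum _ fun k hk => integrable_finsetSum _ fun l hl => hint i hi j hj k hk l hl]
  have e2 : ∀ i ∈ s, ∫ ω, ∑ j ∈ s, ∑ k ∈ s, ∑ l ∈ s,
        w i j * w k l * (resid ε f g (U i ω) (V j ω) * resid ε f g (U k ω) (V l ω)) ∂P =
      ∑ j ∈ s, ∑ k ∈ s, ∑ l ∈ s, ∫ ω,
        w i j * w k l * (resid ε f g (U i ω) (V j ω) * resid ε f g (U k ω) (V l ω)) ∂P := by
    intro i hi
    rw [integral_finsetSum _ fun j hj => integrable_finsetSum _ fun k hk =>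
      integrable_finsetSum _ fun l hl => hint i hi j hj k hk l hl]
    refine Finset.sum_congr rfl fun j hj => ?_
    rw [integral_finsetSum _ fun k hk => integrable_finsetSum _ fun l hl =>
      hint i hi j hj k hk l hl]
    refine Finset.sum_congr rfl fun k hk => ?_
    rw [integral_finsetSum _ fun l hl => hint i hi j hj k hk l hl]
  rw [Finset.sum_congr rfl e2]
  calc _ ≤ ∑ i ∈ s, ∑ j ∈ s, ∑ k ∈ s, ∑ l ∈ s,
      (near m i j * near m k l + near m i k * near m j l + near m i l * near m j k) * D := by
        refine Finset.sum_le_sum fun i hi => Finset.sum_le_sum fun j hj =>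
          Finset.sum_le_sum fun k hk => Finset.sum_le_sum fun l hl => ?_
        have hn : 0 ≤ near m i j * near m k l + near m i k * near m j l +
            near m i l * near m j k := by
          have n1 := mul_nonneg (near_nonneg m i j) (near_nonneg m k l)
          have n2 := mul_nonneg (near_nonneg m i k) (near_nonneg m j l)
          have n3 := mul_nonneg (near_nonneg m i l) (near_nonneg m j k)
          linarith
        have hi' := hmem i hi
        have hj' := hmem j hj
        have hk' := hmem k hk
        have hl' := hmem l hl
        rw [integral_const_mul]
        rcases exists_near_pairing m i j k l with h | h
        · rw [M.integral_resid_mul_eq_zero hε hi' hj' hk' hl' h, mul_zero]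
          exact mul_nonneg hn hD0
        -- The moment bound is assumed only where the weight is nonzero; this is what lets the
        -- one-sample case omit its diagonal, where the points coincide.
        · by_cases hz : w i j = 0 ∨ w k l = 0
          · have : w i j * w k l = 0 := by rcases hz with hz | hz <;> simp [hz]
            rw [this, zero_mul]
            exact mul_nonneg hn hD0
          · push Not at hz
            have h1 := abs_integral_mul_le_half (hL2 i j hi' hj') (hL2 k l hk' hl')
            have h2 := hD i j hi' hj' hz.1
            have h3 := hD k l hk' hl' hz.2
            have h4 : |w i j * w k l| ≤ 1 := by
              rw [abs_mul]
              exact mul_le_one₀ (hw i j) (abs_nonneg _) (hw k l)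
            calc _ ≤ |w i j * w k l *
                  ∫ ω, resid ε f g (U i ω) (V j ω) * resid ε f g (U k ω) (V l ω) ∂P| :=
                  le_abs_self _
              _ ≤ 1 * D := by
                  rw [abs_mul]
                  exact mul_le_mul h4 (by linarith) (abs_nonneg _) zero_le_one
              _ ≤ _ := mul_le_mul_of_nonneg_right h hD0
    _ ≤ _ := by
        simp_rw [← Finset.sum_mul]
        exact mul_le_mul_of_nonneg_right (sum_near_pairing_le m n) hD0

end PairModel

lemma sq_integral_le_integral_sq {α : Type*} [MeasurableSpace α] {μ : Measure α}
    [IsProbabilityMeasure μ] {u : α → ℝ} (hu : MemLp u 2 μ) :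
    (∫ x, u x ∂μ) ^ 2 ≤ ∫ x, u x ^ 2 ∂μ := by
  have h1 := variance_nonneg u μ
  rw [variance_eq_sub hu] at h1
  have h2 : ∫ x, (u ^ 2) x ∂μ = ∫ x, u x ^ 2 ∂μ := rfl
  linarith

lemma ballVol_le_one_eventually {d : ℕ} (hd : 1 ≤ d) : ∀ᶠ ε in 𝓝[>] (0 : ℝ), ballVol d ε ≤ 1 := by
  have h1 : Tendsto (fun ε : ℝ => ε ^ d * ballVol d 1) (𝓝[>] 0) (𝓝 0) := by
    have : Continuous fun ε : ℝ => ε ^ d * ballVol d 1 := by fun_prop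
    have h := (this.tendsto 0).mono_left (nhdsWithin_le_nhds (s := Set.Ioi 0))
    simpa [show d ≠ 0 by omega] using h
  filter_upwards [h1.eventually_le_const zero_lt_one, self_mem_nhdsWithin] with ε h hε
  rwa [ballVol_eq (le_of_lt hε)]

/-! ### Weighted statistics and moment bounds uniform in the indices. -/

/-- Weights `w i j ∈ {0, 1}`, invariant under diagonal shifts, whose row and column sums over
`1, …, n` are all equal to `ρ n ≥ n / 2`. -/
structure IsWeight (w : ℕ → ℕ → ℝ) (ρ : ℕ → ℝ) : Prop where
  zero_or_one : ∀ i j, w i j = 0 ∨ w i j = 1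
  shift : ∀ i j k, w (i + k) (j + k) = w i j
  row : ∀ n, ∀ i ∈ Finset.Icc 1 n, ∑ j ∈ Finset.Icc 1 n, w i j = ρ n
  col : ∀ n, ∀ j ∈ Finset.Icc 1 n, ∑ i ∈ Finset.Icc 1 n, w i j = ρ n
  half_le : ∀ n : ℕ, 2 ≤ n → (n : ℝ) / 2 ≤ ρ n

/-- The weighted proportion of `ε`-close pairs, normalised by the volume of the ball. -/
noncomputable def weightedStat {Ω : Type*} {d : ℕ} (w : ℕ → ℕ → ℝ) (ρ : ℕ → ℝ)
    (U V : ℕ → Ω → EuclideanSpace ℝ (Fin d)) (ε : ℝ) (n : ℕ) (ω : Ω) : ℝ :=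
  (1 / (n * ρ n)) *
    (∑ i ∈ Finset.Icc 1 n, ∑ j ∈ Finset.Icc 1 n, w i j * close ε (U i ω) (V j ω)) / ballVol d ε

namespace PairModel

variable {Ω : Type*} [MeasurableSpace Ω] {P : Measure Ω} {d m : ℕ}
  {U V : ℕ → Ω → EuclideanSpace ℝ (Fin d)} {f g : EuclideanSpace ℝ (Fin d) → ℝ} {ε : ℝ}

lemma integral_comp_U (M : PairModel P m U V f g) {i : ℕ} (hi : 1 ≤ i)
    {φ : EuclideanSpace ℝ (Fin d) → ℝ} (hφ : Measurable φ) :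
    ∫ ω, φ (U i ω) ∂P = ∫ x, φ x ∂(P.map (U 1)) := by
  rw [← M.mapU hi, integral_map (M.measU i hi).aemeasurable hφ.aestronglyMeasurable]

lemma integral_comp_V (M : PairModel P m U V f g) {i : ℕ} (hi : 1 ≤ i)
    {φ : EuclideanSpace ℝ (Fin d) → ℝ} (hφ : Measurable φ) :
    ∫ ω, φ (V i ω) ∂P = ∫ x, φ x ∂(P.map (V 1)) := by
  rw [← M.mapV hi, integral_map (M.measV i hi).aemeasurable hφ.aestronglyMeasurable]

lemma memLp_g (M : PairModel P m U V f g) : MemLp g 2 (P.map (U 1)) :=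
  memLp_two_of_density M.measf M.f_nonneg M.memU M.densU.2.2 M.measg M.g_nonneg M.memV

lemma memLp_f (M : PairModel P m U V f g) : MemLp f 2 (P.map (V 1)) :=
  memLp_two_of_density M.measg M.g_nonneg M.memV M.densV.2.2 M.measf M.f_nonneg M.memU

lemma integral_g (M : PairModel P m U V f g) : ∫ x, g x ∂(P.map (U 1)) = ∫ x, f x * g x :=
  integral_of_density M.measf M.f_nonneg M.densU.2.2 g

lemma integral_f (M : PairModel P m U V f g) : ∫ x, f x ∂(P.map (V 1)) = ∫ x, f x * g x := by
  rw [integral_of_density M.measg M.g_nonneg M.densV.2.2 f]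
  simp_rw [mul_comm]

lemma integral_sq_le_of_sub {α : Type*} [MeasurableSpace α] {μ : Measure α} {u v : α → ℝ}
    (hu : MemLp u 2 μ) (hv : MemLp v 2 μ) :
    ∫ x, u x ^ 2 ∂μ ≤ 2 * (∫ x, (u x - v x) ^ 2 ∂μ) + 2 * ∫ x, v x ^ 2 ∂μ := by
  have h1 : Integrable (fun x => (u x - v x) ^ 2) μ := (hu.sub hv).integrable_sq
  rw [← integral_const_mul, ← integral_const_mul,
    ← integral_add (h1.const_mul 2) (hv.integrable_sq.const_mul 2)]
  refine integral_mono hu.integrable_sq ((h1.const_mul 2).add (hv.integrable_sq.const_mul 2))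
    fun x => ?_
  beta_reduce
  nlinarith [sq_nonneg (u x - 2 * v x)]

lemma integral_close_shift (M : PairModel P m U V f g) {s t : ℕ} (hs : 1 ≤ s) (ht : 1 ≤ t)
    (k : ℕ) :
    ∫ ω, close ε (U (s + k) ω) (V (t + k) ω) ∂P = ∫ ω, close ε (U s ω) (V t ω) ∂P := by
  have h1 := M.stat.map_pair_eq (fun _ => M.measW) hs ht k
  have h2 := congrArg (fun ρ => ∫ p, close ε p.1.1 p.2.2 ∂ρ) h1
  beta_reduce at h2
  have hm : Measurable fun p : (EuclideanSpace ℝ (Fin d) × EuclideanSpace ℝ (Fin d)) ×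
      EuclideanSpace ℝ (Fin d) × EuclideanSpace ℝ (Fin d) => close ε p.1.1 p.2.2 := by fun_prop
  rwa [integral_map ((M.measW (by omega)).prodMk (M.measW (by omega))).aemeasurable
      hm.aestronglyMeasurable,
    integral_map ((M.measW hs).prodMk (M.measW ht)).aemeasurable hm.aestronglyMeasurable] at h2

variable [IsProbabilityMeasure P]

lemma memLp_smooth_g (M : PairModel P m U V f g) : MemLp (smooth ε g) 2 (P.map (U 1)) :=
  have := M.isProb_U
  memLp_smooth M.measg M.g_nonneg M.integrable_g 2

lemma memLp_smooth_f (M : PairModel P m U V f g) : MemLp (smooth ε f) 2 (P.map (V 1)) :=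
  have := M.isProb_V
  memLp_smooth M.measf M.f_nonneg M.integrable_f 2

lemma tendsto_smooth_g (M : PairModel P m U V f g) :
    Tendsto (fun ε => ∫ x, (smooth ε g x - g x) ^ 2 ∂(P.map (U 1))) (𝓝[>] 0) (𝓝 0) :=
  tendsto_integral_smooth_sub_sq M.measf M.f_nonneg M.memU M.densU.2.2 M.measg M.g_nonneg
    M.integrable_g M.memV

lemma tendsto_smooth_f (M : PairModel P m U V f g) :
    Tendsto (fun ε => ∫ x, (smooth ε f x - f x) ^ 2 ∂(P.map (V 1))) (𝓝[>] 0) (𝓝 0) :=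
  tendsto_integral_smooth_sub_sq M.measg M.g_nonneg M.memV M.densV.2.2 M.measf M.f_nonneg
    M.integrable_f M.memU

lemma smoothMean_sub_sq_le (M : PairModel P m U V f g) :
    (smoothMean ε f g - ∫ x, f x * g x) ^ 2 ≤ ∫ x, (smooth ε g x - g x) ^ 2 ∂(P.map (U 1)) := by
  have := M.isProb_U
  rw [M.smoothMean_eq_left, ← M.integral_g, ← integral_sub
    (M.memLp_smooth_g.integrable one_le_two) (M.memLp_g.integrable one_le_two)]
  exact sq_integral_le_integral_sq (M.memLp_smooth_g.sub M.memLp_g)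

lemma tendsto_smoothMean_sub_sq (M : PairModel P m U V f g) :
    Tendsto (fun ε => (smoothMean ε f g - ∫ x, f x * g x) ^ 2) (𝓝[>] 0) (𝓝 0) :=
  squeeze_zero (fun _ => sq_nonneg _) (fun _ => M.smoothMean_sub_sq_le) M.tendsto_smooth_g

lemma exists_smooth_bound (M : PairModel P m U V f g) :
    ∃ G : ℝ, 0 ≤ G ∧ ∀ᶠ ε in 𝓝[>] (0 : ℝ), ∫ x, smooth ε g x ^ 2 ∂(P.map (U 1)) ≤ G ∧
      ∫ x, smooth ε f x ^ 2 ∂(P.map (V 1)) ≤ G := by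
  have hg0 : 0 ≤ ∫ x, g x ^ 2 ∂(P.map (U 1)) := integral_nonneg fun x => sq_nonneg _
  have hf0 : 0 ≤ ∫ x, f x ^ 2 ∂(P.map (V 1)) := integral_nonneg fun x => sq_nonneg _
  refine ⟨2 + 2 * (∫ x, g x ^ 2 ∂(P.map (U 1))) + 2 * ∫ x, f x ^ 2 ∂(P.map (V 1)),
    by linarith, ?_⟩
  filter_upwards [M.tendsto_smooth_g.eventually_le_const zero_lt_one,
    M.tendsto_smooth_f.eventually_le_const zero_lt_one] with ε h1 h2
  have h3 := integral_sq_le_of_sub (M.memLp_smooth_g (ε := ε)) M.memLp_g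
  have h4 := integral_sq_le_of_sub (M.memLp_smooth_f (ε := ε)) M.memLp_f
  constructor <;> linarith

lemma integral_close_of_far (M : PairModel P m U V f g) (hε : 0 < ε) {i j : ℕ} (hi : 1 ≤ i)
    (hj : 1 ≤ j) (hij : j + m < i ∨ i + m < j) :
    ∫ ω, close ε (U i ω) (V j ω) ∂P = smoothMean ε f g * ballVol d ε := by
  have := M.isProb_U
  have := M.isProb_V
  have h1 : IndepFun (U i) (V j) P :=
    (indepFun_of_far (fun _ => M.measW) M.mdep hi hj hij).comp measurable_fst measurable_snd
  have h2 := integral_map (μ := P) ((M.measU i hi).prodMk (M.measV j hj)).aemeasurable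
    (f := fun p => close ε p.1 p.2) measurable_close.aestronglyMeasurable
  rw [← h2, h1.map_prod_eq_prod_map_map (M.measU i hi).aemeasurable (M.measV j hj).aemeasurable,
    M.mapU hi, M.mapV hj, integral_prod, M.smoothMean_eq_left]
  · simp_rw [smooth_eq_integral M.measg M.g_nonneg M.densV.2.2]
    rw [integral_div, div_mul_cancel₀ _ (ballVol_pos hε).ne']
  · refine Integrable.of_bound (C := 1) measurable_close.aestronglyMeasurable
      (Eventually.of_forall fun p => ?_)
    rw [Real.norm_of_nonneg (close_nonneg _ _)]
    exact close_le_one _ _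

/-- The given constants may depend on the pair. Pairs more than `m` apart are independent and have
mean `smoothMean ε f g * ballVol d ε`; by stationarity the other pairs reduce to finitely many. -/
lemma exists_close_bound (M : PairModel P m U V f g) {w : ℕ → ℕ → ℝ} {ρ : ℕ → ℝ}
    (hw : IsWeight w ρ) {C : ℕ → ℕ → ℝ}
    (hC : ∀ i j, 1 ≤ i → 1 ≤ j → w i j ≠ 0 → ∀ ε, 0 < ε →
      ∫ ω, close ε (U i ω) (V j ω) ∂P ≤ C i j * ballVol d ε) :
    ∃ C' : ℝ, 0 ≤ C' ∧ ∀ᶠ ε in 𝓝[>] (0 : ℝ), ∀ i j, 1 ≤ i → 1 ≤ j → w i j ≠ 0 →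
      ∫ ω, close ε (U i ω) (V j ω) ∂P ≤ C' * ballVol d ε := by
  set K := ∑ s ∈ Finset.Icc 1 (m + 1), ∑ t ∈ Finset.Icc 1 (m + 1), |C s t| with hK
  have hK0 : 0 ≤ K := Finset.sum_nonneg fun s _ => Finset.sum_nonneg fun t _ => abs_nonneg _
  set q := ∫ x, f x * g x with hq
  have hq0 : 0 ≤ q := integral_nonneg fun x => mul_nonneg (M.f_nonneg x) (M.g_nonneg x)
  refine ⟨K + (q + 1), by linarith, ?_⟩
  filter_upwards [self_mem_nhdsWithin,
    M.tendsto_smoothMean_sub_sq.eventually_le_const zero_lt_one] with ε hε h1 i j hi hj hij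
  have hε : 0 < ε := hε
  have hb := ballVol_pos (d := d) hε
  by_cases hfar : j + m < i ∨ i + m < j
  · rw [M.integral_close_of_far hε hi hj hfar]
    have h2 := (abs_le_of_sq_le_sq' (by linarith : (smoothMean ε f g - q) ^ 2 ≤ 1 ^ 2)
      zero_le_one).2
    exact mul_le_mul_of_nonneg_right (by linarith) hb.le
  · obtain ⟨s, t, k, hs, hs', ht, ht', rfl, rfl⟩ : ∃ s t k, 1 ≤ s ∧ s ≤ m + 1 ∧ 1 ≤ t ∧
        t ≤ m + 1 ∧ i = s + k ∧ j = t + k := by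
      refine ⟨i - (min i j - 1), j - (min i j - 1), min i j - 1, ?_, ?_, ?_, ?_, ?_, ?_⟩ <;>
        omega
    rw [hw.shift] at hij
    rw [M.integral_close_shift hs ht]
    refine (hC s t hs ht hij ε hε).trans (mul_le_mul_of_nonneg_right ?_ hb.le)
    have h2 : |C s t| ≤ K :=
      (Finset.single_le_sum (f := fun t => |C s t|) (fun t _ => abs_nonneg _)
        (Finset.mem_Icc.2 ⟨ht, ht'⟩)).trans
      (Finset.single_le_sum (f := fun s => ∑ t ∈ Finset.Icc 1 (m + 1), |C s t|)
        (fun s _ => Finset.sum_nonneg fun t _ => abs_nonneg _) (Finset.mem_Icc.2 ⟨hs, hs'⟩))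
    linarith [le_abs_self (C s t)]

/-- The kernel is an indicator, so its normalised square has mean `E close / b²`, of order `1/b`.
The smoothed terms have bounded second moments, absorbed into `1/b` once `b ≤ 1`. -/
lemma exists_resid_bound (M : PairModel P m U V f g) (hd : 1 ≤ d) {w : ℕ → ℕ → ℝ} {ρ : ℕ → ℝ}
    (hw : IsWeight w ρ) {C : ℕ → ℕ → ℝ}
    (hC : ∀ i j, 1 ≤ i → 1 ≤ j → w i j ≠ 0 → ∀ ε, 0 < ε →
      ∫ ω, close ε (U i ω) (V j ω) ∂P ≤ C i j * ballVol d ε) :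
    ∃ C' : ℝ, 0 ≤ C' ∧ ∀ᶠ ε in 𝓝[>] (0 : ℝ), ∀ i j, 1 ≤ i → 1 ≤ j → w i j ≠ 0 →
      ∫ ω, resid ε f g (U i ω) (V j ω) ^ 2 ∂P ≤ C' / ballVol d ε := by
  obtain ⟨C₁, hC₁, h1⟩ := M.exists_close_bound hw hC
  obtain ⟨G, hG, h2⟩ := M.exists_smooth_bound
  refine ⟨4 * (C₁ + 3 * G), by positivity, ?_⟩
  filter_upwards [self_mem_nhdsWithin, h1, h2, ballVol_le_one_eventually hd]
    with ε hε h1 h2 hb1 i j hi hj hij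
  have hε : 0 < ε := hε
  have hb := ballVol_pos (d := d) hε
  have := M.isProb_U
  have hmg := M.measg
  have hmf := M.measf
  have hU := M.measU i hi
  have hV := M.measV j hj
  have bdd : ∀ {u : Ω → ℝ}, Measurable u → ∀ B : ℝ, (∀ ω, |u ω| ≤ B) → Integrable u P :=
    fun hu B hB => Integrable.of_bound hu.aestronglyMeasurable B (Eventually.of_forall hB)
  have ic : Integrable (fun ω => close ε (U i ω) (V j ω) / ballVol d ε ^ 2) P :=
    (bdd (by fun_prop) 1 fun ω => by
      rw [abs_of_nonneg (close_nonneg _ _)]; exact close_le_one _ _).div_const _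
  have ig : Integrable (fun ω => smooth ε g (U i ω) ^ 2) P :=
    bdd (by fun_prop) ((1 / ballVol d ε) ^ 2) fun ω => by
      rw [abs_of_nonneg (sq_nonneg _)]
      exact pow_le_pow_left₀ (smooth_nonneg M.g_nonneg _) (M.smooth_g_le _) 2
  have jf : Integrable (fun ω => smooth ε f (V j ω) ^ 2) P :=
    bdd (by fun_prop) ((1 / ballVol d ε) ^ 2) fun ω => by
      rw [abs_of_nonneg (sq_nonneg _)]
      exact pow_le_pow_left₀ (smooth_nonneg M.f_nonneg _) (M.smooth_f_le _) 2
  have iall : Integrable (fun ω => 4 * (close ε (U i ω) (V j ω) / ballVol d ε ^ 2 +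
      smooth ε g (U i ω) ^ 2 + smooth ε f (V j ω) ^ 2 + smoothMean ε f g ^ 2)) P :=
    (((ic.add ig).add jf).add (integrable_const _)).const_mul 4
  have hc2 : smoothMean ε f g ^ 2 ≤ G := by
    rw [M.smoothMean_eq_left]
    exact (sq_integral_le_integral_sq M.memLp_smooth_g).trans h2.1
  have hGb : G ≤ G / ballVol d ε := by
    rw [le_div_iff₀ hb]
    exact mul_le_of_le_one_right hG hb1
  calc ∫ ω, resid ε f g (U i ω) (V j ω) ^ 2 ∂P
      ≤ ∫ ω, 4 * (close ε (U i ω) (V j ω) / ballVol d ε ^ 2 +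
      smooth ε g (U i ω) ^ 2 + smooth ε f (V j ω) ^ 2 + smoothMean ε f g ^ 2) ∂P := by
        refine integral_mono_of_nonneg (Eventually.of_forall fun ω => sq_nonneg _) iall
          (Eventually.of_forall fun ω => ?_)
        have e : close ε (U i ω) (V j ω) / ballVol d ε ^ 2 =
            (close ε (U i ω) (V j ω) / ballVol d ε) ^ 2 := by rw [div_pow, close_sq]
        simp only [resid, e]
        generalize close ε (U i ω) (V j ω) / ballVol d ε = a
        generalize smooth ε g (U i ω) = b
        generalize smooth ε f (V j ω) = c
        generalize smoothMean ε f g = e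
        nlinarith [sq_nonneg (a + b), sq_nonneg (a + c), sq_nonneg (a - e), sq_nonneg (b - c),
          sq_nonneg (b + e), sq_nonneg (c + e)]
    _ = 4 * ((∫ ω, close ε (U i ω) (V j ω) ∂P) / ballVol d ε ^ 2 +
        (∫ x, smooth ε g x ^ 2 ∂(P.map (U 1))) + (∫ x, smooth ε f x ^ 2 ∂(P.map (V 1))) +
        smoothMean ε f g ^ 2) := by
        have i2 : Integrable (fun ω => close ε (U i ω) (V j ω) / ballVol d ε ^ 2 +
          smooth ε g (U i ω) ^ 2) P := ic.add ig
        have i3 : Integrable (fun ω => close ε (U i ω) (V j ω) / ballVol d ε ^ 2 +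
          smooth ε g (U i ω) ^ 2 + smooth ε f (V j ω) ^ 2) P := i2.add jf
        rw [integral_const_mul, integral_add i3 (integrable_const _), integral_add i2 jf,
          integral_add ic ig, integral_div,
          M.integral_comp_U hi (φ := fun x => smooth ε g x ^ 2) (by fun_prop),
          M.integral_comp_V hj (φ := fun x => smooth ε f x ^ 2) (by fun_prop)]
        simp
    _ ≤ 4 * (C₁ / ballVol d ε + G / ballVol d ε + G / ballVol d ε + G / ballVol d ε) := by
        have e : (∫ ω, close ε (U i ω) (V j ω) ∂P) / ballVol d ε ^ 2 ≤ C₁ / ballVol d ε := by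
          rw [div_le_div_iff₀ (by positivity) hb]
          nlinarith [h1 i j hi hj hij]
        linarith [h2.1, h2.2]
    _ = _ := by ring

end PairModel

/-! ### Elementary mean square inequalities. -/

section MeanSquare

variable {Ω : Type*} [MeasurableSpace Ω] {P : Measure Ω} {u v w : Ω → ℝ}

lemma integral_add_sq_le (hu : MemLp u 2 P) (hv : MemLp v 2 P) :
    ∫ ω, (u ω + v ω) ^ 2 ∂P ≤ 2 * (∫ ω, u ω ^ 2 ∂P) + 2 * ∫ ω, v ω ^ 2 ∂P := by
  rw [← integral_const_mul, ← integral_const_mul,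
    ← integral_add (hu.integrable_sq.const_mul 2) (hv.integrable_sq.const_mul 2)]
  refine integral_mono (hu.add hv).integrable_sq
    ((hu.integrable_sq.const_mul 2).add (hv.integrable_sq.const_mul 2)) fun ω => ?_
  beta_reduce
  nlinarith [sq_nonneg (u ω - v ω)]

lemma memLp_add_add (hu : MemLp u 2 P) (hv : MemLp v 2 P) (hw : MemLp w 2 P) :
    MemLp (fun ω => u ω + v ω + w ω) 2 P :=
  (hu.add hv).add hw

lemma integral_add_add_sq_le (hu : MemLp u 2 P) (hv : MemLp v 2 P) (hw : MemLp w 2 P) :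
    ∫ ω, (u ω + v ω + w ω) ^ 2 ∂P ≤
      3 * (∫ ω, u ω ^ 2 ∂P) + 3 * (∫ ω, v ω ^ 2 ∂P) + 3 * ∫ ω, w ω ^ 2 ∂P := by
  have i1 := hu.integrable_sq.const_mul 3
  have i2 := hv.integrable_sq.const_mul 3
  have i3 := hw.integrable_sq.const_mul 3
  have i12 : Integrable (fun ω => 3 * u ω ^ 2 + 3 * v ω ^ 2) P := i1.add i2
  rw [← integral_const_mul, ← integral_const_mul, ← integral_const_mul, ← integral_add i1 i2,
    ← integral_add i12 i3]
  refine integral_mono ((hu.add hv).add hw).integrable_sq (i12.add i3) fun ω => ?_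
  beta_reduce
  nlinarith [sq_nonneg (u ω - v ω), sq_nonneg (u ω - w ω), sq_nonneg (v ω - w ω)]

/-- Cauchy–Schwarz from the discriminant of the nonnegative quadratic `t ↦ ∫ (u + t v)²`. -/
lemma sq_integral_mul_le (hu : MemLp u 2 P) (hv : MemLp v 2 P) :
    (∫ ω, u ω * v ω ∂P) ^ 2 ≤ (∫ ω, u ω ^ 2 ∂P) * ∫ ω, v ω ^ 2 ∂P := by
  have h : ∀ t : ℝ, 0 ≤ (∫ ω, v ω ^ 2 ∂P) * (t * t) + (2 * ∫ ω, u ω * v ω ∂P) * t +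
      ∫ ω, u ω ^ 2 ∂P := by
    intro t
    have i1 : Integrable (fun ω => v ω ^ 2 * (t * t)) P := hv.integrable_sq.mul_const _
    have i2 : Integrable (fun ω => 2 * (u ω * v ω) * t) P :=
      ((hu.integrable_mul hv).const_mul 2).mul_const t
    have i12 : Integrable (fun ω => v ω ^ 2 * (t * t) + 2 * (u ω * v ω) * t) P := i1.add i2
    rw [← integral_mul_const, ← integral_const_mul, ← integral_mul_const, ← integral_add i1 i2,
      ← integral_add i12 hu.integrable_sq]
    refine integral_nonneg fun ω => ?_
    have : v ω ^ 2 * (t * t) + 2 * (u ω * v ω) * t + u ω ^ 2 = (u ω + t * v ω) ^ 2 := by ring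
    simp only [Pi.zero_apply]
    rw [this]
    positivity
  have := discrim_le_zero h
  rw [discrim] at this
  linarith

lemma abs_integral_add_sq_sub_le (hu : MemLp u 2 P) (hv : MemLp v 2 P) :
    |(∫ ω, (u ω + v ω) ^ 2 ∂P) - ∫ ω, u ω ^ 2 ∂P| ≤
      (∫ ω, v ω ^ 2 ∂P) + 2 * Real.sqrt ((∫ ω, u ω ^ 2 ∂P) * ∫ ω, v ω ^ 2 ∂P) := by
  have i2 : Integrable (fun ω => 2 * (u ω * v ω)) P := (hu.integrable_mul hv).const_mul 2
  have i12 : Integrable (fun ω => u ω ^ 2 + 2 * (u ω * v ω)) P := hu.integrable_sq.add i2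
  have e : ∀ ω, (u ω + v ω) ^ 2 = u ω ^ 2 + 2 * (u ω * v ω) + v ω ^ 2 := fun ω => by ring
  simp_rw [e]
  rw [integral_add i12 hv.integrable_sq, integral_add hu.integrable_sq i2, integral_const_mul]
  have h1 := Real.abs_le_sqrt (sq_integral_mul_le hu hv)
  have h2 : 0 ≤ ∫ ω, v ω ^ 2 ∂P := integral_nonneg fun ω => sq_nonneg _
  rw [abs_le] at h1 ⊢
  constructor <;> linarith [h1.1, h1.2]

end MeanSquare

/-! ### Hoeffding decomposition and control of its remainders. -/

namespace PairModel

/-- Hoeffding-type decomposition of the estimation error. -/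
lemma weightedStat_sub_eq {Ω : Type*} {d : ℕ} {U V : ℕ → Ω → EuclideanSpace ℝ (Fin d)}
    {f g : EuclideanSpace ℝ (Fin d) → ℝ} {ε : ℝ} {w : ℕ → ℕ → ℝ} {ρ : ℕ → ℝ}
    (hw : IsWeight w ρ) (hε : 0 < ε) {n : ℕ} (hn : 2 ≤ n) (q : ℝ) (ω : Ω) :
    weightedStat w ρ U V ε n ω - q -
        2 / n * ∑ i ∈ Finset.Icc 1 n, (1 / 2 * (g (U i ω) + f (V i ω)) - q) =
      2 / n * (∑ i ∈ Finset.Icc 1 n, ((1 / 2 * (smooth ε g (U i ω) + smooth ε f (V i ω)) -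
        1 / 2 * (g (U i ω) + f (V i ω))) - (smoothMean ε f g - q))) +
      1 / (n * ρ n) * (∑ i ∈ Finset.Icc 1 n, ∑ j ∈ Finset.Icc 1 n,
        w i j * resid ε f g (U i ω) (V j ω)) + (smoothMean ε f g - q) := by
  have hb := ballVol_pos (d := d) hε
  have hn0 : (0 : ℝ) < n := by exact_mod_cast (by omega : 0 < n)
  have hρ : 0 < ρ n := lt_of_lt_of_le (by positivity) (hw.half_le n hn)
  set c := smoothMean ε f g with hc
  set s := Finset.Icc 1 n with hs
  have hcard : (s.card : ℝ) = n := by simp [hs]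
  set a := ∑ i ∈ s, smooth ε g (U i ω) with ha
  set b := ∑ i ∈ s, smooth ε f (V i ω) with hb'
  set R := ∑ i ∈ s, ∑ j ∈ s, w i j * resid ε f g (U i ω) (V j ω) with hR
  -- Constant row and column sums are what reduce the weighted double sums of one-variable terms to
  -- unweighted single sums.
  have e1 : ∑ i ∈ s, ∑ j ∈ s, w i j * smooth ε g (U i ω) = ρ n * a := by
    rw [ha, Finset.mul_sum]
    refine Finset.sum_congr rfl fun i hi => ?_
    rw [← Finset.sum_mul, hw.row n i hi]
  have e2 : ∑ i ∈ s, ∑ j ∈ s, w i j * smooth ε f (V j ω) = ρ n * b := by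
    rw [Finset.sum_comm, hb', Finset.mul_sum]
    refine Finset.sum_congr rfl fun j hj => ?_
    rw [← Finset.sum_mul, hw.col n j hj]
  have e3 : ∑ i ∈ s, ∑ j ∈ s, w i j * c = n * ρ n * c := by
    simp_rw [← Finset.sum_mul]
    rw [Finset.sum_congr rfl fun i hi => hw.row n i hi, Finset.sum_const, nsmul_eq_mul, hcard]
  have e4 : ∑ i ∈ s, ∑ j ∈ s, w i j * close ε (U i ω) (V j ω) =
      ballVol d ε * (ρ n * a + ρ n * b - n * ρ n * c + R) := by
    rw [← e1, ← e2, ← e3, hR]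
    simp_rw [← Finset.sum_add_distrib, ← Finset.sum_sub_distrib, ← Finset.sum_add_distrib,
      Finset.mul_sum]
    refine Finset.sum_congr rfl fun i _ => Finset.sum_congr rfl fun j _ => ?_
    rw [resid]
    field_simp
    ring
  rw [weightedStat, e4]
  simp only [Finset.sum_sub_distrib, ← Finset.mul_sum, Finset.sum_add_distrib, Finset.sum_const,
    nsmul_eq_mul, ← ha, ← hb']
  rw [hcard]
  field_simp
  ring

variable {Ω : Type*} [MeasurableSpace Ω] {P : Measure Ω} {d m : ℕ}
  {U V : ℕ → Ω → EuclideanSpace ℝ (Fin d)} {f g : EuclideanSpace ℝ (Fin d) → ℝ} {ε : ℝ}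
  {w : ℕ → ℕ → ℝ} {ρ : ℕ → ℝ}

lemma memLp_comp_U (M : PairModel P m U V f g) {φ : EuclideanSpace ℝ (Fin d) → ℝ}
    (hφ : MemLp φ 2 (P.map (U 1))) : MemLp (fun ω => φ (U 1 ω)) 2 P :=
  (memLp_map_measure_iff hφ.aestronglyMeasurable (M.measU 1 le_rfl).aemeasurable).1 hφ

lemma memLp_comp_V (M : PairModel P m U V f g) {φ : EuclideanSpace ℝ (Fin d) → ℝ}
    (hφ : MemLp φ 2 (P.map (V 1))) : MemLp (fun ω => φ (V 1 ω)) 2 P :=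
  (memLp_map_measure_iff hφ.aestronglyMeasurable (M.measV 1 le_rfl).aemeasurable).1 hφ

lemma memLp_projection (M : PairModel P m U V f g) :
    MemLp (fun ω => 1 / 2 * (g (U 1 ω) + f (V 1 ω))) 2 P :=
  ((M.memLp_comp_U M.memLp_g).add (M.memLp_comp_V M.memLp_f)).const_mul _

variable [IsProbabilityMeasure P]

lemma memLp_smooth_projection (M : PairModel P m U V f g) :
    MemLp (fun ω => 1 / 2 * (smooth ε g (U 1 ω) + smooth ε f (V 1 ω))) 2 P :=
  ((M.memLp_comp_U M.memLp_smooth_g).add (M.memLp_comp_V M.memLp_smooth_f)).const_mul _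

lemma integral_projection (M : PairModel P m U V f g) :
    ∫ ω, 1 / 2 * (g (U 1 ω) + f (V 1 ω)) ∂P = ∫ x, f x * g x := by
  rw [integral_const_mul, integral_add ((M.memLp_comp_U M.memLp_g).integrable one_le_two)
    ((M.memLp_comp_V M.memLp_f).integrable one_le_two), M.integral_comp_U le_rfl M.measg,
    M.integral_comp_V le_rfl M.measf, M.integral_g, M.integral_f]
  ring

lemma integral_smooth_projection (M : PairModel P m U V f g) :
    ∫ ω, 1 / 2 * (smooth ε g (U 1 ω) + smooth ε f (V 1 ω)) ∂P = smoothMean ε f g := by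
  rw [integral_const_mul, integral_add ((M.memLp_comp_U M.memLp_smooth_g).integrable one_le_two)
    ((M.memLp_comp_V M.memLp_smooth_f).integrable one_le_two),
    M.integral_comp_U le_rfl (measurable_smooth M.measg),
    M.integral_comp_V le_rfl (measurable_smooth M.measf), ← M.smoothMean_eq_left,
    ← M.smoothMean_eq_right]
  ring

lemma integral_projection_sub_sq_le (M : PairModel P m U V f g) :
    ∫ ω, (1 / 2 * (smooth ε g (U 1 ω) + smooth ε f (V 1 ω)) -
        1 / 2 * (g (U 1 ω) + f (V 1 ω))) ^ 2 ∂P ≤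
      (∫ x, (smooth ε g x - g x) ^ 2 ∂(P.map (U 1))) +
        ∫ x, (smooth ε f x - f x) ^ 2 ∂(P.map (V 1)) := by
  have hmg := M.measg
  have hmf := M.measf
  have h1 : MemLp (fun ω => 1 / 2 * (smooth ε g (U 1 ω) - g (U 1 ω))) 2 P :=
    (M.memLp_comp_U (M.memLp_smooth_g.sub M.memLp_g)).const_mul _
  have h2 : MemLp (fun ω => 1 / 2 * (smooth ε f (V 1 ω) - f (V 1 ω))) 2 P :=
    (M.memLp_comp_V (M.memLp_smooth_f.sub M.memLp_f)).const_mul _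
  have e : ∀ ω, 1 / 2 * (smooth ε g (U 1 ω) + smooth ε f (V 1 ω)) -
      1 / 2 * (g (U 1 ω) + f (V 1 ω)) = 1 / 2 * (smooth ε g (U 1 ω) - g (U 1 ω)) +
      1 / 2 * (smooth ε f (V 1 ω) - f (V 1 ω)) := fun ω => by ring
  simp_rw [e]
  refine (integral_add_sq_le h1 h2).trans ?_
  simp_rw [mul_pow]
  rw [integral_const_mul, integral_const_mul,
    M.integral_comp_U le_rfl (φ := fun x => (smooth ε g x - g x) ^ 2) (by fun_prop),
    M.integral_comp_V le_rfl (φ := fun x => (smooth ε f x - f x) ^ 2) (by fun_prop)]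
  have n1 : 0 ≤ ∫ x, (smooth ε g x - g x) ^ 2 ∂(P.map (U 1)) := integral_nonneg fun x => sq_nonneg _
  have n2 : 0 ≤ ∫ x, (smooth ε f x - f x) ^ 2 ∂(P.map (V 1)) := integral_nonneg fun x => sq_nonneg _
  linarith

lemma memLp_linear_remainder (M : PairModel P m U V f g) (n : ℕ) (a : ℝ) :
    MemLp (fun ω => 2 / (n : ℝ) * ∑ i ∈ Finset.Icc 1 n,
      ((1 / 2 * (smooth ε g (U i ω) + smooth ε f (V i ω)) - 1 / 2 * (g (U i ω) + f (V i ω))) -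
        a)) 2 P := by
  have hmg := M.measg
  have hmf := M.measf
  have hψm : Measurable fun p : EuclideanSpace ℝ (Fin d) × EuclideanSpace ℝ (Fin d) =>
    1 / 2 * (smooth ε g p.1 + smooth ε f p.2) - 1 / 2 * (g p.1 + f p.2) := by fun_prop
  have h2 : MemLp (fun ω => 1 / 2 * (smooth ε g (U 1 ω) + smooth ε f (V 1 ω)) -
      1 / 2 * (g (U 1 ω) + f (V 1 ω))) 2 P := M.memLp_smooth_projection.sub M.memLp_projection
  refine (memLp_sum_Icc (fun i hi => ?_) n).const_mul _
  have h3 := memLp_comp_stationary (fun _ => M.measW) M.stat hψm h2 hi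
  exact h3.sub (memLp_const a)

/-- The variance bound for `m`-dependent sums, applied to the smoothed minus the original
projection; its variance is at most its second moment, which vanishes with `ε`. -/
lemma integral_linear_remainder_sq_le (M : PairModel P m U V f g) {n : ℕ} (hn : 0 < n) :
    ∫ ω, (2 / (n : ℝ) * ∑ i ∈ Finset.Icc 1 n,
      ((1 / 2 * (smooth ε g (U i ω) + smooth ε f (V i ω)) - 1 / 2 * (g (U i ω) + f (V i ω))) -
        (smoothMean ε f g - ∫ x, f x * g x))) ^ 2 ∂P ≤
      4 * ((2 * m + 1) * ((∫ x, (smooth ε g x - g x) ^ 2 ∂(P.map (U 1))) +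
        ∫ x, (smooth ε f x - f x) ^ 2 ∂(P.map (V 1)))) / n := by
  have hn0 : (0 : ℝ) < n := by exact_mod_cast hn
  have hmg := M.measg
  have hmf := M.measf
  have hψm : Measurable fun p : EuclideanSpace ℝ (Fin d) × EuclideanSpace ℝ (Fin d) =>
    1 / 2 * (smooth ε g p.1 + smooth ε f p.2) - 1 / 2 * (g p.1 + f p.2) := by fun_prop
  have h2 : MemLp (fun ω => 1 / 2 * (smooth ε g (U 1 ω) + smooth ε f (V 1 ω)) -
      1 / 2 * (g (U 1 ω) + f (V 1 ω))) 2 P := M.memLp_smooth_projection.sub M.memLp_projection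
  have hmean : ∫ ω, (1 / 2 * (smooth ε g (U 1 ω) + smooth ε f (V 1 ω)) -
      1 / 2 * (g (U 1 ω) + f (V 1 ω))) ∂P = smoothMean ε f g - ∫ x, f x * g x := by
    rw [integral_sub (M.memLp_smooth_projection.integrable one_le_two)
      (M.memLp_projection.integrable one_le_two), M.integral_smooth_projection,
      M.integral_projection]
  have h1 := integral_centered_sum_sq_le (fun _ => M.measW) M.stat M.mdep hψm h2 n
  have h3 := (variance_le_expectation_sq h2.aestronglyMeasurable).trans
    M.integral_projection_sub_sq_le
  rw [hmean] at h1
  simp only [mul_pow _ (Finset.sum _ _)]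
  rw [integral_const_mul]
  calc _ ≤ (2 / (n : ℝ)) ^ 2 * (n * ((2 * m + 1) *
      ((∫ x, (smooth ε g x - g x) ^ 2 ∂(P.map (U 1))) +
        ∫ x, (smooth ε f x - f x) ^ 2 ∂(P.map (V 1))))) := by
        refine mul_le_mul_of_nonneg_left (h1.trans ?_) (by positivity)
        exact mul_le_mul_of_nonneg_left (mul_le_mul_of_nonneg_left h3 (by positivity)) hn0.le
    _ = _ := by field_simp; ring

lemma memLp_resid_remainder (M : PairModel P m U V f g) (hε : 0 < ε) (n : ℕ) (a : ℝ) :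
    MemLp (fun ω => a * ∑ i ∈ Finset.Icc 1 n, ∑ j ∈ Finset.Icc 1 n,
      w i j * resid ε f g (U i ω) (V j ω)) 2 P := by
  have h1 : ∀ i ∈ Finset.Icc 1 n, ∀ j ∈ Finset.Icc 1 n,
      MemLp (fun ω => w i j * resid ε f g (U i ω) (V j ω)) 2 P := fun i hi j hj =>
    (MemLp.of_bound (M.measurable_resid_comp (M.measU i (Finset.mem_Icc.1 hi).1)
      (M.measV j (Finset.mem_Icc.1 hj).1)).aestronglyMeasurable (2 / ballVol d ε)
      (Eventually.of_forall fun ω => M.abs_resid_le hε _ _)).const_mul _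
  have h2 : ∀ i ∈ Finset.Icc 1 n, MemLp (fun ω => ∑ j ∈ Finset.Icc 1 n,
      w i j * resid ε f g (U i ω) (V j ω)) 2 P := fun i hi => memLp_finsetSum _ (h1 i hi)
  exact (memLp_finsetSum _ h2).const_mul a

lemma integral_resid_remainder_sq_le (M : PairModel P m U V f g) (hw : IsWeight w ρ) (hε : 0 < ε)
    {D : ℝ} (hD0 : 0 ≤ D)
    (hD : ∀ i j, 1 ≤ i → 1 ≤ j → w i j ≠ 0 →
      ∫ ω, resid ε f g (U i ω) (V j ω) ^ 2 ∂P ≤ D / ballVol d ε) {n : ℕ} (hn : 2 ≤ n) :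
    ∫ ω, (1 / (n * ρ n) * ∑ i ∈ Finset.Icc 1 n, ∑ j ∈ Finset.Icc 1 n,
      w i j * resid ε f g (U i ω) (V j ω)) ^ 2 ∂P ≤
      4 * (3 * (4 * m + 1) ^ 2 * D) / (n ^ 2 * ballVol d ε) := by
  have hb := ballVol_pos (d := d) hε
  have hn0 : (0 : ℝ) < n := by exact_mod_cast (by omega : 0 < n)
  have hρ := hw.half_le n hn
  have hρ0 : 0 < ρ n := lt_of_lt_of_le (by positivity) hρ
  have h1 := M.integral_sum_resid_sq_le hε (w := w) (fun i j => by
    rcases hw.zero_or_one i j with h | h <;> simp [h]) hD n (by positivity)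
  simp only [mul_pow _ (Finset.sum _ _)]
  rw [integral_const_mul]
  calc _ ≤ (1 / (n * ρ n)) ^ 2 * (3 * (n * (4 * m + 1)) ^ 2 * (D / ballVol d ε)) :=
        mul_le_mul_of_nonneg_left h1 (by positivity)
    _ = (1 / ρ n) ^ 2 * (3 * (4 * m + 1) ^ 2 * (D / ballVol d ε)) := by field_simp
    _ ≤ (1 / ((n : ℝ) / 2)) ^ 2 * (3 * (4 * m + 1) ^ 2 * (D / ballVol d ε)) := by
        gcongr
    _ = _ := by field_simp; ring

/-- The estimation error is, up to a negligible remainder, a sum of a stationary `m`-dependent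
sequence with variance `4 σ² / n`. -/
theorem exists_linearization (M : PairModel P m U V f g) (hd : 1 ≤ d) (hw : IsWeight w ρ)
    {C : ℕ → ℕ → ℝ}
    (hC : ∀ i j, 1 ≤ i → 1 ≤ j → w i j ≠ 0 → ∀ ε, 0 < ε →
      ∫ ω, close ε (U i ω) (V j ω) ∂P ≤ C i j * ballVol d ε) :
    ∃ A : ℕ → Ω → ℝ, (∀ n, MemLp (A n) 2 P) ∧
      Tendsto (fun n : ℕ => n * ∫ ω, A n ω ^ 2 ∂P) atTop
        (𝓝 (4 * longRunVar P m fun i ω => 1 / 2 * (g (U i ω) + f (V i ω)))) ∧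
      ∃ (C' : ℝ) (δ : ℝ → ℝ), Tendsto δ (𝓝[>] 0) (𝓝 0) ∧ ∀ᶠ ε in 𝓝[>] (0 : ℝ), ∀ n : ℕ, 2 ≤ n →
        MemLp (fun ω => weightedStat w ρ U V ε n ω - (∫ x, f x * g x) - A n ω) 2 P ∧
        ∫ ω, (weightedStat w ρ U V ε n ω - (∫ x, f x * g x) - A n ω) ^ 2 ∂P ≤
          δ ε / n + C' / (n ^ 2 * ballVol d ε) +
            3 * (smoothMean ε f g - ∫ x, f x * g x) ^ 2 := by
  set q := ∫ x, f x * g x with hq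
  have hmg := M.measg
  have hmf := M.measf
  have hW : ∀ i, 1 ≤ i → Measurable fun ω => (U i ω, V i ω) := fun _ => M.measW
  set φ : EuclideanSpace ℝ (Fin d) × EuclideanSpace ℝ (Fin d) → ℝ :=
    fun p => 1 / 2 * (g p.1 + f p.2) with hφ
  have hφm : Measurable φ := by fun_prop
  have hA2 : ∀ i, 1 ≤ i → MemLp (fun ω => φ (U i ω, V i ω)) 2 P := fun i hi =>
    memLp_comp_stationary hW M.stat hφm M.memLp_projection hi
  -- The witness does not involve `ε`: it uses the densities themselves, so its limiting variance is
  -- computed once. The factor `2 / n` undoes the `1 / 2` and gives the `4` in front of the long-run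
  -- variance.
  refine ⟨fun n ω => 2 / n * ∑ i ∈ Finset.Icc 1 n, (1 / 2 * (g (U i ω) + f (V i ω)) - q),
    fun n => (memLp_sum_Icc (fun i hi => (hA2 i hi).sub (memLp_const q)) n).const_mul _, ?_, ?_⟩
  · have h1 := (tendsto_integral_centered_sum_sq_div hW M.stat M.mdep hφm
      M.memLp_projection).const_mul 4
    refine h1.congr' ?_
    filter_upwards [eventually_gt_atTop 0] with n hn
    have hn0 : (0 : ℝ) < n := by exact_mod_cast hn
    have e : ∫ ω, φ (U 1 ω, V 1 ω) ∂P = q := M.integral_projection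
    rw [e]
    simp only [hφ, mul_pow _ (Finset.sum _ _)]
    rw [integral_const_mul]
    field_simp
    ring
  · obtain ⟨D, hD0, hD⟩ := M.exists_resid_bound hd hw hC
    refine ⟨3 * (4 * (3 * (4 * m + 1) ^ 2 * D)), fun ε => 3 * (4 * ((2 * m + 1) *
      ((∫ x, (smooth ε g x - g x) ^ 2 ∂(P.map (U 1))) +
        ∫ x, (smooth ε f x - f x) ^ 2 ∂(P.map (V 1))))), ?_, ?_⟩
    · have h := (((M.tendsto_smooth_g.add M.tendsto_smooth_f).const_mul
        (2 * (m : ℝ) + 1)).const_mul 4).const_mul 3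
      simpa using h
    filter_upwards [self_mem_nhdsWithin, hD] with ε hε hD n hn
    have hε : 0 < ε := hε
    simp_rw [weightedStat_sub_eq (f := f) (g := g) hw hε hn q]
    have hL2 := M.memLp_linear_remainder (ε := ε) n (smoothMean ε f g - q)
    have hR2 := M.memLp_resid_remainder (w := w) hε n (1 / (n * ρ n))
    have hLb := M.integral_linear_remainder_sq_le (ε := ε) (show 0 < n by omega)
    have hRb := M.integral_resid_remainder_sq_le hw hε hD0 hD hn
    set c := smoothMean ε f g with hc
    rw [← hq] at hLb
    refine ⟨memLp_add_add hL2 hR2 (memLp_const (c - q)), ?_⟩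
    refine (integral_add_add_sq_le hL2 hR2 (memLp_const (c - q))).trans ?_
    have e : ∫ _, (c - q) ^ 2 ∂P = (c - q) ^ 2 := by simp
    rw [e]
    have e1 : ∀ a : ℝ, 3 * (4 * a) / (n : ℝ) = 3 * (4 * a / n) := fun a => by ring
    have e2 : 3 * (4 * (3 * (4 * (m : ℝ) + 1) ^ 2 * D)) / (n ^ 2 * ballVol d ε) =
      3 * (4 * (3 * (4 * m + 1) ^ 2 * D) / (n ^ 2 * ballVol d ε)) := by ring
    rw [e1, e2]
    linarith

end PairModel

/-! ### Asymptotic equivalence and slow variation. -/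

section RealAsymptotics

lemma eventually_comparable {u v : ℕ → ℝ} (h : u ~[atTop] v) (hv : ∀ᶠ n in atTop, 0 < v n) :
    ∀ᶠ n in atTop, v n / 2 ≤ u n ∧ u n ≤ 2 * v n := by
  have h1 : Tendsto (u / v) atTop (𝓝 1) :=
    (isEquivalent_iff_tendsto_one (hv.mono fun n hn => hn.ne')).1 h
  filter_upwards [hv, h1.eventually_const_le (by norm_num : (1 / 2 : ℝ) < 1),
    h1.eventually_le_const (by norm_num : (1 : ℝ) < 2)] with n h0 h2 h3
  rw [Pi.div_apply, le_div_iff₀ h0] at h2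
  rw [Pi.div_apply, div_le_iff₀ h0] at h3
  constructor <;> linarith

/-- A slowly varying sequence grows more slowly than any positive power. -/
lemma SlowlyVarying.exists_le_rpow {L : ℕ → ℝ} (hL : SlowlyVarying L) {η : ℝ} (hη : 0 < η) :
    ∃ A : ℝ, 0 < A ∧ ∀ n : ℕ, 1 ≤ n → L n ≤ A * (n : ℝ) ^ η := by
  -- Halving alone suffices: `L n ≤ 2^η L (n/2)` for large `n`, and the factor `2^η` is exactly what
  -- `(n/2)^η` loses against `n^η`.
  have h1 := hL.2 (1 / 2) (by norm_num)
  have h2 : (2 : ℝ) ^ (-η) < 1 := Real.rpow_lt_one_of_one_lt_of_neg (by norm_num) (by linarith)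
  have h3 : ∀ᶠ n : ℕ in atTop, L n ≤ 2 ^ η * L (n / 2) := by
    filter_upwards [hL.1, h1.eventually_const_le h2] with n hn hn2
    have e : ⌊1 / 2 * (n : ℝ)⌋₊ = n / 2 := by
      rw [show 1 / 2 * (n : ℝ) = (n : ℝ) / (2 : ℕ) by push_cast; ring]
      exact Nat.floor_div_eq_div n 2
    rw [e, le_div_iff₀ hn, Real.rpow_neg (by norm_num), inv_mul_le_iff₀ (by positivity)] at hn2
    exact hn2
  obtain ⟨N, hN⟩ := eventually_atTop.1 h3
  have hpos : 0 ≤ ∑ k ∈ Finset.range (N + 2), |L k| := Finset.sum_nonneg fun k _ => abs_nonneg _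
  -- The sum covers the initial values. The threshold `N + 2` ensures both `N ≤ n` and `1 ≤ n / 2`
  -- in the inductive case.
  refine ⟨∑ k ∈ Finset.range (N + 2), |L k| + 1, by linarith, ?_⟩
  set A := ∑ k ∈ Finset.range (N + 2), |L k| + 1 with hA
  intro n
  induction n using Nat.strong_induction_on with
  | _ n ih =>
    intro hn
    have hn1 : (1 : ℝ) ≤ n := by exact_mod_cast hn
    by_cases hlt : n < N + 2
    · have h4 : |L n| ≤ ∑ k ∈ Finset.range (N + 2), |L k| :=
        Finset.single_le_sum (f := fun k => |L k|) (fun k _ => abs_nonneg _)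
          (Finset.mem_range.2 hlt)
      have h5 : 1 ≤ (n : ℝ) ^ η := Real.one_le_rpow hn1 hη.le
      have h6 : A ≤ A * (n : ℝ) ^ η := le_mul_of_one_le_right (by linarith) h5
      linarith [le_abs_self (L n)]
    · have h4 := hN n (by omega)
      have h5 := ih (n / 2) (by omega) (by omega)
      have h6 : ((n / 2 : ℕ) : ℝ) ^ η ≤ ((n : ℝ) / 2) ^ η :=
        Real.rpow_le_rpow (by positivity) (by exact_mod_cast Nat.cast_div_le) hη.le
      calc L n ≤ 2 ^ η * L (n / 2) := h4
        _ ≤ 2 ^ η * (A * ((n : ℝ) / 2) ^ η) := by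
            refine mul_le_mul_of_nonneg_left (h5.trans ?_) (by positivity)
            exact mul_le_mul_of_nonneg_left h6 (by linarith)
        _ = A * (n : ℝ) ^ η := by
            rw [Real.div_rpow (by linarith) (by norm_num)]
            field_simp

end RealAsymptotics

/-! ### From the linearization to the mean square error. -/

/-- Closeness means that the difference lies in the ball around `0`, whose probability is at most
the density bound times its volume. -/
lemma HasBoundedDensity.exists_integral_close_le {Ω : Type*} [MeasurableSpace Ω] {P : Measure Ω}
    {d : ℕ} {u v : Ω → EuclideanSpace ℝ (Fin d)} (hu : Measurable u) (hv : Measurable v)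
    (h : HasBoundedDensity P fun ω => u ω - v ω) :
    ∃ C : ℝ, ∀ ε, 0 < ε → ∫ ω, close ε (u ω) (v ω) ∂P ≤ C * ballVol d ε := by
  obtain ⟨f, ⟨hfm, hf0, hf⟩, C, hC⟩ := h
  refine ⟨C, fun ε hε => ?_⟩
  have hm : Measurable fun z : EuclideanSpace ℝ (Fin d) => close ε 0 z := by fun_prop
  have h1 : ∫ ω, close ε (u ω) (v ω) ∂P = ∫ z, f z * close ε 0 z := by
    simp_rw [close_eq_close_zero_sub (u _)]
    rw [← integral_of_density hfm hf0 hf]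
    exact (integral_map (hu.sub hv).aemeasurable hm.aestronglyMeasurable).symm
  rw [h1, ← integral_close (0 : EuclideanSpace ℝ (Fin d)), ← integral_const_mul]
  exact integral_mono_of_nonneg
    (Eventually.of_forall fun z => mul_nonneg (hf0 z) (close_nonneg _ _))
    ((integrable_close 0).const_mul C)
    (Eventually.of_forall fun z => mul_le_mul_of_nonneg_right (hC z) (close_nonneg _ _))

lemma mse_le_of_decomposition {Ω : Type*} [MeasurableSpace Ω] {P : Measure Ω} {T A : Ω → ℝ}
    {q : ℝ} (hA : MemLp A 2 P) (hB : MemLp (fun ω => T ω - q - A ω) 2 P) :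
    mse P T q ≤ 2 * (∫ ω, A ω ^ 2 ∂P) + 2 * ∫ ω, (T ω - q - A ω) ^ 2 ∂P := by
  have h := integral_add_sq_le hA hB
  simpa [mse] using h

lemma abs_mse_sub_le_of_decomposition {Ω : Type*} [MeasurableSpace Ω] {P : Measure Ω}
    {T A : Ω → ℝ} {q : ℝ} (hA : MemLp A 2 P) (hB : MemLp (fun ω => T ω - q - A ω) 2 P) :
    |mse P T q - ∫ ω, A ω ^ 2 ∂P| ≤ (∫ ω, (T ω - q - A ω) ^ 2 ∂P) +
      2 * Real.sqrt ((∫ ω, A ω ^ 2 ∂P) * ∫ ω, (T ω - q - A ω) ^ 2 ∂P) := by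
  have h := abs_integral_add_sq_sub_le hA hB
  simpa [mse] using h

/-! ### The three regimes for the weighted statistic. -/

namespace PairModel

variable {Ω : Type*} [MeasurableSpace Ω] {P : Measure Ω} [IsProbabilityMeasure P] {d m : ℕ}
  {U V : ℕ → Ω → EuclideanSpace ℝ (Fin d)} {f g : EuclideanSpace ℝ (Fin d) → ℝ}
  {w : ℕ → ℕ → ℝ} {ρ : ℕ → ℝ} {C : ℕ → ℕ → ℝ} {ε : ℕ → ℝ}

/-- The crude splitting of a square is enough for consistency and for the rate, where the constant
of `1/n` is irrelevant. -/
lemma exists_mse_le (M : PairModel P m U V f g) (hd : 1 ≤ d) (hw : IsWeight w ρ)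
    (hC : ∀ i j, 1 ≤ i → 1 ≤ j → w i j ≠ 0 → ∀ ε, 0 < ε →
      ∫ ω, close ε (U i ω) (V j ω) ∂P ≤ C i j * ballVol d ε)
    (hε : Tendsto ε atTop (𝓝[>] 0)) :
    ∃ K : ℝ, 0 < K ∧ ∀ᶠ n : ℕ in atTop,
      mse P (weightedStat w ρ U V (ε n) n) (∫ x, f x * g x) ≤
        K * (1 / n + 1 / (n ^ 2 * ballVol d (ε n)) +
          (smoothMean (ε n) f g - ∫ x, f x * g x) ^ 2) := by
  obtain ⟨A, hA2, hA, C', δ, hδ, hB⟩ := M.exists_linearization hd hw hC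
  set q := ∫ x, f x * g x with hq
  set S := 4 * longRunVar P m fun i ω => 1 / 2 * (g (U i ω) + f (V i ω)) with hS
  refine ⟨2 * (|S| + 1) + 2 * (|C'| + 4), by positivity, ?_⟩
  filter_upwards [hε.eventually hB, eventually_ge_atTop 2,
    (hδ.comp hε).eventually_le_const zero_lt_one,
    hA.eventually_le_const (lt_of_le_of_lt (le_abs_self S) (lt_add_one |S|)),
    hε.eventually self_mem_nhdsWithin] with n hB hn hδ hA hε
  have hε : 0 < ε n := hε
  have hb := ballVol_pos (d := d) hε
  have hn0 : (0 : ℝ) < n := by exact_mod_cast (by omega : 0 < n)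
  obtain ⟨hB2, hB⟩ := hB n hn
  have h1 := mse_le_of_decomposition (hA2 n) hB2
  have h2 : ∫ ω, A n ω ^ 2 ∂P ≤ (|S| + 1) * (1 / n) := by
    rw [mul_one_div, le_div_iff₀ hn0]; linarith
  have h3 : δ (ε n) / n ≤ 1 / n := div_le_div_of_nonneg_right hδ hn0.le
  have h4 : C' / (n ^ 2 * ballVol d (ε n)) ≤ |C'| * (1 / (n ^ 2 * ballVol d (ε n))) := by
    rw [mul_one_div]
    exact div_le_div_of_nonneg_right (le_abs_self _) (by positivity)
  have p1 : 0 ≤ 1 / (n : ℝ) := by positivity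
  have p2 : 0 ≤ 1 / ((n : ℝ) ^ 2 * ballVol d (ε n)) := by positivity
  have p3 := sq_nonneg (smoothMean (ε n) f g - q)
  nlinarith [abs_nonneg S, abs_nonneg C', mul_nonneg (abs_nonneg S) p2,
    mul_nonneg (abs_nonneg S) p3, mul_nonneg (abs_nonneg C') p1, mul_nonneg (abs_nonneg C') p3]

/-- The exact constant survives because, after multiplication by `n`, the remainder tends to zero in
mean square while the linear term stays bounded; Cauchy–Schwarz then removes the cross term. -/
lemma tendsto_mul_mse (M : PairModel P m U V f g) (hd : 1 ≤ d) (hw : IsWeight w ρ)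
    (hC : ∀ i j, 1 ≤ i → 1 ≤ j → w i j ≠ 0 → ∀ ε, 0 < ε →
      ∫ ω, close ε (U i ω) (V j ω) ∂P ≤ C i j * ballVol d ε)
    (hε : Tendsto ε atTop (𝓝[>] 0))
    (h1 : Tendsto (fun n : ℕ => 1 / (n * ballVol d (ε n))) atTop (𝓝 0))
    (h2 : Tendsto (fun n : ℕ => n * (smoothMean (ε n) f g - ∫ x, f x * g x) ^ 2) atTop (𝓝 0)) :
    Tendsto (fun n : ℕ => n * mse P (weightedStat w ρ U V (ε n) n) (∫ x, f x * g x)) atTop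
      (𝓝 (4 * longRunVar P m fun i ω => 1 / 2 * (g (U i ω) + f (V i ω)))) := by
  obtain ⟨A, hA2, hA, C', δ, hδ, hB⟩ := M.exists_linearization hd hw hC
  set q := ∫ x, f x * g x with hq
  set S := 4 * longRunVar P m fun i ω => 1 / 2 * (g (U i ω) + f (V i ω)) with hS
  have hBlim : Tendsto (fun n : ℕ => n * ∫ ω,
      (weightedStat w ρ U V (ε n) n ω - q - A n ω) ^ 2 ∂P) atTop (𝓝 0) := by
    have h3 : Tendsto (fun n : ℕ => δ (ε n) + C' * (1 / (n * ballVol d (ε n))) +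
        3 * (n * (smoothMean (ε n) f g - q) ^ 2)) atTop (𝓝 0) := by
      simpa using ((hδ.comp hε).add (h1.const_mul C')).add (h2.const_mul 3)
    refine tendsto_of_tendsto_of_tendsto_of_le_of_le' tendsto_const_nhds h3
      (Eventually.of_forall fun n => mul_nonneg (Nat.cast_nonneg n)
        (integral_nonneg fun ω => sq_nonneg _)) ?_
    filter_upwards [hε.eventually hB, eventually_ge_atTop 2] with n hB hn
    have hn0 : (0 : ℝ) < n := by exact_mod_cast (by omega : 0 < n)
    calc _ ≤ n * (δ (ε n) / n + C' / (n ^ 2 * ballVol d (ε n)) +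
          3 * (smoothMean (ε n) f g - q) ^ 2) :=
          mul_le_mul_of_nonneg_left (hB n hn).2 hn0.le
      _ = _ := by
          rw [mul_add, mul_add, mul_div_cancel₀ _ hn0.ne']
          congr 1
          · congr 1
            rw [sq, mul_assoc, div_mul_eq_div_div, mul_div_left_comm, mul_one_div]
            field_simp
          · ring
  have hdiff : Tendsto (fun n : ℕ => n * mse P (weightedStat w ρ U V (ε n) n) q -
      n * ∫ ω, A n ω ^ 2 ∂P) atTop (𝓝 0) := by
    have h3 : Tendsto (fun n : ℕ => (n * ∫ ω,
        (weightedStat w ρ U V (ε n) n ω - q - A n ω) ^ 2 ∂P) +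
        2 * Real.sqrt ((n * ∫ ω, A n ω ^ 2 ∂P) * (n * ∫ ω,
        (weightedStat w ρ U V (ε n) n ω - q - A n ω) ^ 2 ∂P))) atTop (𝓝 0) := by
      have h4 := hBlim.add (((hA.mul hBlim).sqrt).const_mul 2)
      simpa using h4
    refine squeeze_zero_norm' ?_ h3
    filter_upwards [hε.eventually hB, eventually_ge_atTop 2] with n hB hn
    have hn0 : (0 : ℝ) < n := by exact_mod_cast (by omega : 0 < n)
    have h5 := abs_mse_sub_le_of_decomposition (hA2 n) (hB n hn).1
    rw [← mul_sub, Real.norm_eq_abs, abs_mul, abs_of_pos hn0]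
    refine (mul_le_mul_of_nonneg_left h5 hn0.le).trans_eq ?_
    rw [mul_mul_mul_comm, Real.sqrt_mul (mul_self_nonneg (n : ℝ)), Real.sqrt_mul_self hn0.le]
    ring
  have := hdiff.add hA
  simpa using this

/-- Mean square consistency. -/
theorem tendsto_mse (M : PairModel P m U V f g) (hd : 1 ≤ d) (hw : IsWeight w ρ)
    (hC : ∀ i j, 1 ≤ i → 1 ≤ j → w i j ≠ 0 → ∀ ε, 0 < ε →
      ∫ ω, close ε (U i ω) (V j ω) ∂P ≤ C i j * ballVol d ε)
    (hε : Tendsto ε atTop (𝓝[>] 0))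
    (h : Tendsto (fun n : ℕ => (n : ℝ) ^ 2 * ε n ^ d) atTop atTop) :
    Tendsto (fun n : ℕ => mse P (weightedStat w ρ U V (ε n) n) (∫ x, f x * g x)) atTop (𝓝 0) := by
  obtain ⟨K, hK, hle⟩ := M.exists_mse_le hd hw hC hε
  have hb1 := ballVol_pos (d := d) one_pos
  have h1 : Tendsto (fun n : ℕ => 1 / ((n : ℝ) ^ 2 * ballVol d (ε n))) atTop (𝓝 0) := by
    have h2 := (h.atTop_mul_const hb1).inv_tendsto_atTop
    refine h2.congr' ?_
    filter_upwards [hε.eventually self_mem_nhdsWithin] with n hn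
    rw [ballVol_eq (le_of_lt hn), Pi.inv_apply, one_div, mul_assoc]
  have h3 : Tendsto (fun n : ℕ => K * (1 / (n : ℝ) + 1 / (n ^ 2 * ballVol d (ε n)) +
      (smoothMean (ε n) f g - ∫ x, f x * g x) ^ 2)) atTop (𝓝 0) := by
    simpa using ((tendsto_one_div_atTop_nhds_zero_nat.add h1).add
      (M.tendsto_smoothMean_sub_sq.comp hε)).const_mul K
  exact tendsto_of_tendsto_of_tendsto_of_le_of_le' tendsto_const_nhds h3
    (Eventually.of_forall fun n => integral_nonneg fun ω => sq_nonneg _) hle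

lemma smoothMean_sub_sq_le_of_holder (M : PairModel P m U V f g) {α K r : ℝ} (hα : 0 ≤ α)
    (hf : HolderL2 α K f) (hg : HolderL2 α K g) (hr : 0 < r) (hr1 : r ≤ 1) :
    (smoothMean r f g - ∫ x, f x * g x) ^ 2 ≤ K ^ 4 * r ^ (4 * α) := by
  have h1 := abs_integral_mul_smooth_sub_le hα hr hr1 M.measf M.measg M.integrable_f
    M.integrable_g hf hg
  have h2 := pow_le_pow_left₀ (abs_nonneg _) h1 2
  rw [sq_abs] at h2
  refine h2.trans_eq ?_
  rw [mul_comm 4 α, Real.rpow_mul hr.le, show (4 : ℝ) = (4 : ℕ) by norm_num, Real.rpow_natCast]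
  ring

/-- Convergence rate under low smoothness. -/
theorem mse_isBigO (M : PairModel P m U V f g) (hd : 1 ≤ d) (hw : IsWeight w ρ)
    (hC : ∀ i j, 1 ≤ i → 1 ≤ j → w i j ≠ 0 → ∀ ε, 0 < ε →
      ∫ ω, close ε (U i ω) (V j ω) ∂P ≤ C i j * ballVol d ε)
    (hε : Tendsto ε atTop (𝓝[>] 0)) {α K c : ℝ} (hα : 0 < α) (hc : 0 < c)
    (hf : HolderL2 α K f) (hg : HolderL2 α K g) (hαd : α ≤ (d : ℝ) / 4)
    (hεc : ε ~[atTop] fun n : ℕ => c * (n : ℝ) ^ (-(2 / (4 * α + (d : ℝ))))) :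
    (fun n : ℕ => mse P (weightedStat w ρ U V (ε n) n) (∫ x, f x * g x)) =O[atTop]
      fun n : ℕ => (n : ℝ) ^ (-(8 * α / (4 * α + (d : ℝ)))) := by
  obtain ⟨D, hD, hle⟩ := M.exists_mse_le hd hw hC hε
  have hd0 : (0 : ℝ) < d := by exact_mod_cast (by omega : 0 < d)
  have hs : 0 < 4 * α + (d : ℝ) := by positivity
  set β := 2 / (4 * α + (d : ℝ)) with hβ
  set κ := 8 * α / (4 * α + (d : ℝ)) with hκ
  have hb1 := ballVol_pos (d := d) one_pos
  -- This is where `α ≤ d/4` enters: the `1/n` term is no larger than the target rate.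
  have hκ1 : κ ≤ 1 := by rw [hκ, div_le_one hs]; linarith
  -- The next two identities express the balance: with `ε` of order `n^(-β)`, both `1/(n² ε^d)` and
  -- `ε^(4α)` are of order `n^(-κ)`.
  have e1 : β * d = 2 - κ := by rw [hβ, hκ]; field_simp; ring
  have e2 : β * (4 * α) = κ := by rw [hβ, hκ]; field_simp; ring
  refine IsBigO.of_bound (D * (1 + 1 / ((c / 2) ^ d * ballVol d 1) +
    K ^ 4 * (2 * c) ^ (4 * α))) ?_
  have hv : ∀ᶠ n : ℕ in atTop, 0 < c * (n : ℝ) ^ (-β) := by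
    filter_upwards [eventually_gt_atTop 0] with n hn
    have : (0 : ℝ) < n := by exact_mod_cast hn
    positivity
  filter_upwards [hle, eventually_comparable hεc hv, eventually_ge_atTop 1,
    hε.eventually self_mem_nhdsWithin,
    (tendsto_nhds_of_tendsto_nhdsWithin hε).eventually_le_const zero_lt_one]
    with n hle hcmp hn hpos hone
  have hpos : 0 < ε n := hpos
  have hn1 : (1 : ℝ) ≤ n := by exact_mod_cast hn
  have hn0 : (0 : ℝ) < n := by linarith
  have t1 : 1 / (n : ℝ) ≤ (n : ℝ) ^ (-κ) := by
    rw [one_div, ← Real.rpow_neg_one]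
    exact Real.rpow_le_rpow_of_exponent_le hn1 (by linarith)
  have t2 : 1 / ((n : ℝ) ^ 2 * ballVol d (ε n)) ≤
      1 / ((c / 2) ^ d * ballVol d 1) * (n : ℝ) ^ (-κ) := by
    have h1 : (c / 2 * (n : ℝ) ^ (-β)) ^ d ≤ ε n ^ d :=
      pow_le_pow_left₀ (by positivity) (by linarith [hcmp.1]) d
    have h2 : ((n : ℝ) ^ (-β)) ^ d = (n : ℝ) ^ κ * ((n : ℝ) ^ 2)⁻¹ := by
      rw [← Real.rpow_natCast, ← Real.rpow_mul hn0.le, ← Real.rpow_natCast (n : ℝ) 2,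
        ← Real.rpow_neg hn0.le, ← Real.rpow_add hn0]
      congr 1
      push_cast
      linarith
    rw [mul_pow, h2] at h1
    rw [ballVol_eq hpos.le, Real.rpow_neg hn0.le, ← one_div, one_div_mul_one_div]
    refine one_div_le_one_div_of_le (by positivity) ?_
    calc _ = (n : ℝ) ^ 2 * ((c / 2) ^ d * ((n : ℝ) ^ κ * ((n : ℝ) ^ 2)⁻¹) * ballVol d 1) := by
          field_simp
      _ ≤ (n : ℝ) ^ 2 * (ε n ^ d * ballVol d 1) := by gcongr
      _ = _ := by ring
  have t3 : (smoothMean (ε n) f g - ∫ x, f x * g x) ^ 2 ≤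
      K ^ 4 * (2 * c) ^ (4 * α) * (n : ℝ) ^ (-κ) := by
    refine (M.smoothMean_sub_sq_le_of_holder hα.le hf hg hpos hone).trans ?_
    have h1 : ε n ^ (4 * α) ≤ (2 * c * (n : ℝ) ^ (-β)) ^ (4 * α) :=
      Real.rpow_le_rpow hpos.le (by linarith [hcmp.2]) (by positivity)
    rw [Real.mul_rpow (by positivity) (by positivity), ← Real.rpow_mul hn0.le, neg_mul, e2] at h1
    rw [mul_assoc]
    exact mul_le_mul_of_nonneg_left h1 (by positivity)
  have hm0 : 0 ≤ mse P (weightedStat w ρ U V (ε n) n) (∫ x, f x * g x) :=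
    integral_nonneg fun ω => sq_nonneg _
  rw [Real.norm_of_nonneg hm0, Real.norm_of_nonneg (by positivity)]
  refine hle.trans ?_
  rw [mul_assoc]
  refine mul_le_mul_of_nonneg_left ?_ hD.le
  linarith

/-- Exact first order asymptotics under high smoothness. -/
theorem mse_sub_isLittleO (M : PairModel P m U V f g) (hd : 1 ≤ d) (hw : IsWeight w ρ)
    (hC : ∀ i j, 1 ≤ i → 1 ≤ j → w i j ≠ 0 → ∀ ε, 0 < ε →
      ∫ ω, close ε (U i ω) (V j ω) ∂P ≤ C i j * ballVol d ε)
    (hε : Tendsto ε atTop (𝓝[>] 0)) {α K : ℝ} {L : ℕ → ℝ} (hα : 0 < α)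
    (hf : HolderL2 α K f) (hg : HolderL2 α K g) (hαd : (d : ℝ) / 4 < α)
    (hL : SlowlyVarying L) (hLtop : Tendsto L atTop atTop)
    (hεL : ε ~[atTop] fun n : ℕ => L n * (n : ℝ) ^ (-(1 / (d : ℝ)))) :
    (fun n : ℕ => mse P (weightedStat w ρ U V (ε n) n) (∫ x, f x * g x) -
        4 * (longRunVar P m fun i ω => 1 / 2 * (g (U i ω) + f (V i ω))) / (n : ℝ)) =o[atTop]
      fun n : ℕ => 1 / (n : ℝ) := by
  have hd0 : (0 : ℝ) < d := by exact_mod_cast (by omega : 0 < d)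
  have hb1 := ballVol_pos (d := d) one_pos
  have hv : ∀ᶠ n : ℕ in atTop, 0 < L n * (n : ℝ) ^ (-(1 / (d : ℝ))) := by
    filter_upwards [eventually_gt_atTop 0, hL.1] with n hn hLn
    have : (0 : ℝ) < n := by exact_mod_cast hn
    positivity
  have hcmp := eventually_comparable hεL hv
  -- Here `n ε^d` is comparable to `L^d`, so divergence of `L` is what makes the degenerate part
  -- negligible.
  have h1 : Tendsto (fun n : ℕ => 1 / (n * ballVol d (ε n))) atTop (𝓝 0) := by
    have h2 : Tendsto (fun n => (L n / 2) ^ d * ballVol d 1) atTop atTop :=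
      ((tendsto_pow_atTop (by omega)).comp (hLtop.atTop_div_const two_pos)).atTop_mul_const hb1
    refine tendsto_of_tendsto_of_tendsto_of_le_of_le' tendsto_const_nhds h2.inv_tendsto_atTop ?_ ?_
    · filter_upwards [hε.eventually self_mem_nhdsWithin] with n hn
      have := ballVol_pos (d := d) hn
      positivity
    · filter_upwards [hcmp, hL.1, eventually_gt_atTop 0, hε.eventually self_mem_nhdsWithin]
        with n hcmp hLn hn hpos
      have hpos : 0 < ε n := hpos
      have hn0 : (0 : ℝ) < n := by exact_mod_cast hn
      have h3 : (L n / 2 * (n : ℝ) ^ (-(1 / (d : ℝ)))) ^ d ≤ ε n ^ d :=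
        pow_le_pow_left₀ (by positivity) (by linarith [hcmp.1]) d
      have h4 : ((n : ℝ) ^ (-(1 / (d : ℝ)))) ^ d = (n : ℝ)⁻¹ := by
        rw [← Real.rpow_natCast, ← Real.rpow_mul hn0.le, neg_mul, one_div_mul_cancel hd0.ne',
          Real.rpow_neg_one]
      rw [mul_pow, h4] at h3
      rw [Pi.inv_apply, ← one_div, ballVol_eq hpos.le]
      refine one_div_le_one_div_of_le (by positivity) ?_
      calc _ = (n : ℝ) * ((L n / 2) ^ d * (n : ℝ)⁻¹ * ballVol d 1) := by field_simp
        _ ≤ (n : ℝ) * (ε n ^ d * ballVol d 1) := by gcongr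
  have h2 : Tendsto (fun n : ℕ => n * (smoothMean (ε n) f g - ∫ x, f x * g x) ^ 2) atTop (𝓝 0) := by
    have hgap : 0 < 4 * α / d - 1 := by
      rw [sub_pos, lt_div_iff₀ hd0]; linarith
    set τ := 4 * α / d - 1 with hτ
    -- With this exponent `L^(4α)` costs at most `n^(τ/2)`, half of the gap `τ`, so `n ε^(4α)` still
    -- decays like `n^(-τ/2)`.
    obtain ⟨A, hA, hLA⟩ := hL.exists_le_rpow (η := τ / (8 * α)) (by positivity)
    have h3 : Tendsto (fun n : ℕ => K ^ 4 * (2 * A) ^ (4 * α) * (n : ℝ) ^ (-(τ / 2))) atTop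
        (𝓝 0) := by
      have := ((tendsto_rpow_neg_atTop (half_pos hgap)).comp
        tendsto_natCast_atTop_atTop).const_mul (K ^ 4 * (2 * A) ^ (4 * α))
      simpa using this
    refine tendsto_of_tendsto_of_tendsto_of_le_of_le' tendsto_const_nhds h3
      (Eventually.of_forall fun n => by positivity) ?_
    filter_upwards [hcmp, eventually_ge_atTop 1, hε.eventually self_mem_nhdsWithin,
      (tendsto_nhds_of_tendsto_nhdsWithin hε).eventually_le_const zero_lt_one]
      with n hcmp hn hpos hone
    have hpos : 0 < ε n := hpos
    have hn0 : (0 : ℝ) < n := by exact_mod_cast hn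
    have h4 := M.smoothMean_sub_sq_le_of_holder hα.le hf hg hpos hone
    have h5 : ε n ≤ 2 * A * (n : ℝ) ^ (τ / (8 * α) - 1 / d) := by
      refine hcmp.2.trans ?_
      rw [sub_eq_add_neg, Real.rpow_add hn0, mul_assoc 2 A, ← mul_assoc A]
      have := hLA n hn
      gcongr
    have h6 : ε n ^ (4 * α) ≤ (2 * A) ^ (4 * α) * (n : ℝ) ^ (-(τ / 2) - 1) := by
      refine (Real.rpow_le_rpow hpos.le h5 (by positivity)).trans_eq ?_
      rw [Real.mul_rpow (by positivity) (by positivity), ← Real.rpow_mul hn0.le]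
      congr 2
      rw [hτ]
      field_simp
      ring
    calc (n : ℝ) * (smoothMean (ε n) f g - ∫ x, f x * g x) ^ 2
        ≤ n * (K ^ 4 * ((2 * A) ^ (4 * α) * (n : ℝ) ^ (-(τ / 2) - 1))) := by
          refine mul_le_mul_of_nonneg_left (h4.trans ?_) hn0.le
          exact mul_le_mul_of_nonneg_left h6 (by positivity)
      _ = _ := by
          rw [Real.rpow_sub_one hn0.ne']
          field_simp
  have h3 := M.tendsto_mul_mse hd hw hC hε h1 h2
  rw [isLittleO_iff_tendsto' (by
    filter_upwards [eventually_gt_atTop 0] with n hn h0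
    have hn0 : (0 : ℝ) < n := by exact_mod_cast hn
    exact absurd h0 (by positivity))]
  have h4 := h3.sub_const (4 * longRunVar P m fun i ω => 1 / 2 * (g (U i ω) + f (V i ω)))
  rw [sub_self] at h4
  refine h4.congr' ?_
  filter_upwards [eventually_gt_atTop 0] with n hn
  have hn0 : (0 : ℝ) < n := by exact_mod_cast hn
  field_simp

end PairModel

/-! ### The two statistics as weighted statistics. -/

lemma isWeight_one : IsWeight (fun _ _ => 1) (fun n => (n : ℝ)) where
  zero_or_one _ _ := Or.inr rfl
  shift _ _ _ := rfl
  row n _ _ := by simp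
  col n _ _ := by simp
  half_le n _ := half_le_self (Nat.cast_nonneg n)

/-- The weights that exclude the diagonal. -/
noncomputable def offDiag (i j : ℕ) : ℝ := if i = j then 0 else 1

lemma offDiag_comm (i j : ℕ) : offDiag i j = offDiag j i := by
  simp only [offDiag, eq_comm]

lemma sum_offDiag (n : ℕ) {i : ℕ} (hi : i ∈ Finset.Icc 1 n) :
    ∑ j ∈ Finset.Icc 1 n, offDiag i j = n - 1 := by
  have h : ∀ j, offDiag i j = 1 - if i = j then 1 else 0 := fun j => by
    unfold offDiag; split_ifs <;> norm_num
  simp_rw [h, Finset.sum_sub_distrib, Finset.sum_ite_eq, if_pos hi]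
  simp

lemma isWeight_offDiag : IsWeight offDiag (fun n => (n : ℝ) - 1) where
  zero_or_one i j := by unfold offDiag; split_ifs <;> simp
  shift i j k := by simp [offDiag]
  row n i hi := sum_offDiag n hi
  col n j hj := by
    simp_rw [offDiag_comm _ j]
    exact sum_offDiag n hj
  half_le n hn := by
    have : (2 : ℝ) ≤ n := by exact_mod_cast hn
    linarith

lemma sum_offDiag_mul (a : ℕ → ℕ → ℝ) (ha : ∀ i j, a i j = a j i) (n : ℕ) :
    ∑ i ∈ Finset.Icc 1 n, ∑ j ∈ Finset.Icc 1 n, offDiag i j * a i j =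
      2 * ∑ j ∈ Finset.Icc 1 n, ∑ i ∈ Finset.Ico 1 j, a i j := by
  induction n with
  | zero => simp
  | succ n ih =>
    have h1 : ∀ i ∈ Finset.Icc 1 n, offDiag i (n + 1) * a i (n + 1) = a i (n + 1) := by
      intro i hi
      rw [Finset.mem_Icc] at hi
      rw [offDiag, if_neg (by omega), one_mul]
    have h2 : ∀ j ∈ Finset.Icc 1 n, offDiag (n + 1) j * a (n + 1) j = a j (n + 1) := by
      intro j hj
      rw [offDiag_comm, ha, h1 j hj]
    have h3 : Finset.Ico 1 (n + 1) = Finset.Icc 1 n := rfl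
    rw [Finset.sum_Icc_succ_top (by omega)]
    simp_rw [Finset.sum_Icc_succ_top (show 1 ≤ n + 1 by omega)]
    rw [Finset.sum_add_distrib, ih, Finset.sum_congr rfl h1, Finset.sum_congr rfl h2, h3,
      offDiag, if_pos rfl]
    ring

variable {Ω : Type*} {d : ℕ}

lemma weightedStat_one (X Y : ℕ → Ω → EuclideanSpace ℝ (Fin d)) (ε : ℝ) (n : ℕ) :
    weightedStat (fun _ _ => 1) (fun n => (n : ℝ)) X Y ε n = Q11Tilde X Y ε n := by
  funext ω
  simp only [weightedStat, Q11Tilde, Q11, one_mul, sq]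

lemma weightedStat_offDiag (X : ℕ → Ω → EuclideanSpace ℝ (Fin d)) (ε : ℝ) (n : ℕ) :
    weightedStat offDiag (fun n => (n : ℝ) - 1) X X ε n = Q20Tilde X ε n := by
  funext ω
  rw [weightedStat, Q20Tilde, Q20, sum_offDiag_mul (fun i j => close ε (X i ω) (X j ω))
    (fun i j => close_comm _ _), Nat.cast_choose_two, one_div_div]
  congr 1
  rw [← mul_assoc, one_div_mul_eq_div]

end ClosePairs

theorem theorem1 {Ω : Type*} [MeasurableSpace Ω] (P : Measure Ω) [IsProbabilityMeasure P]
    (d : ℕ) (hd : 1 ≤ d) (m : ℕ)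
    (X Y : ℕ → Ω → EuclideanSpace ℝ (Fin d))
    (hX : ∀ i, 1 ≤ i → Measurable (X i)) (hY : ∀ i, 1 ≤ i → Measurable (Y i))
    (pX pY : EuclideanSpace ℝ (Fin d) → ℝ)
    (hpX : ClosePairs.IsDensity P (X 1) pX) (hpY : ClosePairs.IsDensity P (Y 1) pY)
    (hpX3 : MemLp pX 3 volume) (hpY3 : MemLp pY 3 volume)
    -- the paired sequence is strictly stationary and `m`-dependent
    (hstat : ClosePairs.StrictlyStationary P (fun i ω => (X i ω, Y i ω)))
    (hmdep : ClosePairs.MDependent P m (fun i ω => (X i ω, Y i ω)))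
    -- differences have bounded densities
    (hXX : ∀ s : ℕ, 1 ≤ s → ClosePairs.HasBoundedDensity P (fun ω => X 1 ω - X (1 + s) ω))
    (hXY : ∀ s t : ℕ, 1 ≤ s → 1 ≤ t → ClosePairs.HasBoundedDensity P (fun ω => X s ω - Y t ω))
    (ε : ℕ → ℝ) (hε : ∀ n, 1 ≤ n → 0 < ε n) (hε0 : Tendsto ε atTop (𝓝 0)) :
    -- (i) mean square consistency
    (Tendsto (fun n : ℕ => (n : ℝ) ^ 2 * ε n ^ d) atTop atTop →
      Tendsto (fun n : ℕ => ClosePairs.mse P (ClosePairs.Q20Tilde X (ε n) n)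
        (ClosePairs.qFun pX pY 2 0)) atTop (𝓝 0) ∧
      Tendsto (fun n : ℕ => ClosePairs.mse P (ClosePairs.Q11Tilde X Y (ε n) n)
        (ClosePairs.qFun pX pY 1 1)) atTop (𝓝 0)) ∧
    -- (ii) rate for low smoothness
    (∀ α K c : ℝ, 0 < α → α ≤ 1 → 0 < K → 0 < c →
      ClosePairs.HolderL2 α K pX → ClosePairs.HolderL2 α K pY → α ≤ (d : ℝ) / 4 →
      ε ~[atTop] (fun n : ℕ => c * (n : ℝ) ^ (-(2 / (4 * α + (d : ℝ))))) →
      (fun n : ℕ => ClosePairs.mse P (ClosePairs.Q20Tilde X (ε n) n)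
        (ClosePairs.qFun pX pY 2 0))
        =O[atTop] (fun n : ℕ => (n : ℝ) ^ (-(8 * α / (4 * α + (d : ℝ))))) ∧
      (fun n : ℕ => ClosePairs.mse P (ClosePairs.Q11Tilde X Y (ε n) n)
        (ClosePairs.qFun pX pY 1 1))
        =O[atTop] (fun n : ℕ => (n : ℝ) ^ (-(8 * α / (4 * α + (d : ℝ)))))) ∧
    -- (iii) exact first order asymptotics for high smoothness
    (∀ (α K : ℝ) (L : ℕ → ℝ), 0 < α → α ≤ 1 → 0 < K →
      ClosePairs.HolderL2 α K pX → ClosePairs.HolderL2 α K pY → (d : ℝ) / 4 < α →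
      ClosePairs.SlowlyVarying L → Tendsto L atTop atTop →
      ε ~[atTop] (fun n : ℕ => L n * (n : ℝ) ^ (-(1 / (d : ℝ)))) →
      (fun n : ℕ => ClosePairs.mse P (ClosePairs.Q20Tilde X (ε n) n)
          (ClosePairs.qFun pX pY 2 0) - 4 * ClosePairs.sigmaSq20 P m X pX / (n : ℝ))
        =o[atTop] (fun n : ℕ => 1 / (n : ℝ)) ∧
      (fun n : ℕ => ClosePairs.mse P (ClosePairs.Q11Tilde X Y (ε n) n)
          (ClosePairs.qFun pX pY 1 1) - 4 * ClosePairs.sigmaSq11 P m X Y pX pY / (n : ℝ))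
        =o[atTop] (fun n : ℕ => 1 / (n : ℝ))) := by
  open ClosePairs in
  have hε' : Tendsto ε atTop (𝓝[>] 0) :=
    tendsto_nhdsWithin_iff.2 ⟨hε0, (eventually_ge_atTop 1).mono hε⟩
  have hW : ∀ i, 1 ≤ i → Measurable fun ω => (X i ω, Y i ω) :=
    fun i hi => (hX i hi).prodMk (hY i hi)
  have hdiag : Measurable fun p : EuclideanSpace ℝ (Fin d) × EuclideanSpace ℝ (Fin d) =>
    (p.1, p.1) := by fun_prop
  have M₁ : PairModel P m X Y pX pY := ⟨hX, hY, hpX, hpY, hpX3, hpY3, hstat, hmdep⟩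
  -- The one-sample problem is the two-sample model for the duplicated sequence `(X i, X i)`.
  have M₂ : PairModel P m X X pX pX :=
    ⟨hX, hX, hpX, hpX, hpX3, hpX3, hstat.comp hW hdiag, hmdep.comp hdiag⟩
  have hC₁ : ∀ i j : ℕ, ∃ C : ℝ, 1 ≤ i → 1 ≤ j → (1 : ℝ) ≠ 0 → ∀ ε, 0 < ε →
      ∫ ω, close ε (X i ω) (Y j ω) ∂P ≤ C * ballVol d ε := by
    intro i j
    by_cases h : 1 ≤ i ∧ 1 ≤ j
    · obtain ⟨C, hC⟩ := (hXY i j h.1 h.2).exists_integral_close_le (hX i h.1) (hY j h.2)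
      exact ⟨C, fun _ _ _ => hC⟩
    · exact ⟨0, fun hi hj => absurd ⟨hi, hj⟩ h⟩
  -- The assumption concerns `X 1 - X (1 + s)` only; stationarity moves it to any `i < j`, and
  -- symmetry of `close` then covers `j < i`.
  have hlt : ∀ i j : ℕ, 1 ≤ i → i < j → ∃ C : ℝ, ∀ ε, 0 < ε →
      ∫ ω, close ε (X i ω) (X j ω) ∂P ≤ C * ballVol d ε := by
    intro i j hi hij
    obtain ⟨C, hC⟩ := (hXX (j - i) (by omega)).exists_integral_close_le (hX 1 le_rfl)
      (hX (1 + (j - i)) (by omega))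
    refine ⟨C, fun ε hε => ?_⟩
    have h := M₂.integral_close_shift (ε := ε) le_rfl (show 1 ≤ 1 + (j - i) by omega) (i - 1)
    rw [show 1 + (i - 1) = i by omega, show 1 + (j - i) + (i - 1) = j by omega] at h
    rw [h]
    exact hC ε hε
  have hC₂ : ∀ i j : ℕ, ∃ C : ℝ, 1 ≤ i → 1 ≤ j → offDiag i j ≠ 0 → ∀ ε, 0 < ε →
      ∫ ω, close ε (X i ω) (X j ω) ∂P ≤ C * ballVol d ε := by
    intro i j
    by_cases h : 1 ≤ i ∧ 1 ≤ j ∧ i ≠ j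
    · rcases lt_or_gt_of_ne h.2.2 with hij | hij
      · obtain ⟨C, hC⟩ := hlt i j h.1 hij
        exact ⟨C, fun _ _ _ => hC⟩
      · obtain ⟨C, hC⟩ := hlt j i h.2.1 hij
        simp_rw [close_comm (X j _)] at hC
        exact ⟨C, fun _ _ _ => hC⟩
    · refine ⟨0, fun hi hj hw => absurd ⟨hi, hj, fun hij => hw ?_⟩ h⟩
      rw [offDiag, if_pos hij]
  choose C₁ hC₁ using hC₁
  choose C₂ hC₂ using hC₂
  have hq₁ : qFun pX pY 1 1 = ∫ x, pX x * pY x := by simp [qFun]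
  have hq₂ : qFun pX pY 2 0 = ∫ x, pX x * pX x := by simp [qFun, sq]
  -- For equal densities the projection averages `pX (X i)` with itself, so the general variance is
  -- the one-sample one.
  have hσ₂ : sigmaSq20 P m X pX =
      longRunVar P m fun i ω => 1 / 2 * (pX (X i ω) + pX (X i ω)) := by
    rw [sigmaSq20]
    congr 1
    funext i ω
    ring
  rw [hq₁, hq₂, hσ₂]
  simp_rw [← weightedStat_one, ← weightedStat_offDiag]
  refine ⟨fun h => ⟨M₂.tendsto_mse hd isWeight_offDiag hC₂ hε' h,
    M₁.tendsto_mse hd isWeight_one hC₁ hε' h⟩, ?_, ?_⟩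
  · intro α K c hα _ _ hc hpX hpY hαd hεc
    exact ⟨M₂.mse_isBigO hd isWeight_offDiag hC₂ hε' hα hc hpX hpX hαd hεc,
      M₁.mse_isBigO hd isWeight_one hC₁ hε' hα hc hpX hpY hαd hεc⟩
  · intro α K L hα _ _ hpX hpY hαd hL hLtop hεL
    exact ⟨M₂.mse_sub_isLittleO hd isWeight_offDiag hC₂ hε' hα hpX hpX hαd hL hLtop hεL,
      M₁.mse_sub_isLittleO hd isWeight_one hC₁ hε' hα hpX hpY hαd hL hLtop hεL⟩
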